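/- Let $M$ be a smooth ($C^\infty$), connected, paracompact, Hausdorff, finite-dimensional manifold with tangent bundle $\pi:TM\to M$. A \emph{spray} on $M$ is a smooth vector field $S$ on all of $TM$ with $T\pi(S(v))=v$ for every $v\in TM$; in local coordinates, $S(x,y)=(x,y,y,Y(x,y))$. Let $C$ be the Euler vector field on $TM$, $C(x,y)=(x,y,0,y)$. For real $m\ge 0$, the spray $S$ is \emph{homogeneous of degree $m$} if $[C,S]=(m-1)S$, and $\mathrm{Spr}_m(M)$ denotes the set of these sprays. A curve $c$ in $M$ defined on a nonempty open interval is an \emph{$S$-geodesic} if its natural lift $\dot c$ to $TM$ is an integral curve of $S$; it is \emph{inextendible} if it is not the restriction of an $S$-geodesic defined on a larger open interval. The spray $S$ is \emph{pseudoconvex} if for each compact $K\subseteq M$ there is a compact $K'\subseteq M$ such that each $S$-geodesic segment with both endpoints in $K$ lies entirely in $K'$. It is \emph{disprisoning} if no inextendible nonconstant $S$-geodesic is contained in a compact subset of $M$. Let $h$ be an auxiliary smooth Riemannian metric on $M$ with unit sphere bundle $UM\subset TM$. The \emph{$C^0$-fine (Whitney) topology} on $\mathrm{Spr}_m(M)$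 has as a basis the sets $\{S : S(u)\in O \text{ for all } u\in UM\}$, where $O$ runs over the open subsets of $TTM$. \textbf{Theorem.} If $S\in\mathrm{Spr}_m(M)$ is pseudoconvex and disprisoning, then there is an open neighbourhood $W(S)$ of $S$ in the $C^0$-fine topology on $\mathrm{Spr}_m(M)$ such that every $S'\in W(S)$ is both pseudoconvex and disprisoning. -/

import Mathlib

open Set Topology Bundle
open scoped Manifold ContDiff

noncomputable section

namespace Spr

/-- The tangent bundle `TM` of a manifold `M` modelled (without boundary) on the normed space `E`. -/
abbrev TM (E : Type*) [NormedAddCommGroup E] [NormedSpace ℝ E]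
    (M : Type*) [TopologicalSpace M] [ChartedSpace E M] : Type _ :=
  TangentBundle 𝓘(ℝ, E) M

/-- The second tangent bundle `TTM`, i.e. the tangent bundle of the manifold `TM`. -/
abbrev TTM (E : Type*) [NormedAddCommGroup E] [NormedSpace ℝ E]
    (M : Type*) [TopologicalSpace M] [ChartedSpace E M] [IsManifold 𝓘(ℝ, E) ∞ M] : Type _ :=
  TangentBundle 𝓘(ℝ, E).tangent (TM E M)

/-- A (general) spray on `M`: a smooth vector field `S` on the whole of `TM` such that
`Tπ (S v) = v` for every `v`, where `π : TM → M` is the projection. In local coordinates this says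
`S (x, y) = (x, y, y, Y (x, y))`; equivalently, `S` is fixed by the canonical involution of `TTM`. -/
structure Spray (E : Type*) [NormedAddCommGroup E] [NormedSpace ℝ E]
    (M : Type*) [TopologicalSpace M] [ChartedSpace E M] [IsManifold 𝓘(ℝ, E) ∞ M] where
  /-- the underlying vector field on `TM` -/
  field : (v : TM E M) → TangentSpace 𝓘(ℝ, E).tangent v
  smooth : ContMDiff 𝓘(ℝ, E).tangent 𝓘(ℝ, E).tangent.tangent ∞
    (fun v : TM E M => (⟨v, field v⟩ : TTM E M))
  second_order : ∀ v : TM E M,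
    mfderiv 𝓘(ℝ, E).tangent 𝓘(ℝ, E) (fun w : TM E M => w.proj) v (field v) = v.snd

variable {E : Type*} [NormedAddCommGroup E] [NormedSpace ℝ E]
  {M : Type*} [TopologicalSpace M] [ChartedSpace E M] [IsManifold 𝓘(ℝ, E) ∞ M]

/-- The Euler (Liouville) vector field `C` on `TM`: the velocity at `t = 1` of `t ↦ t • v`. In local
coordinates, `C (x, y) = (x, y, 0, y)`. -/
def euler (v : TM E M) : TangentSpace 𝓘(ℝ, E).tangent v :=
  mfderiv 𝓘(ℝ, ℝ) 𝓘(ℝ, E).tangent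
    (fun t : ℝ => (⟨v.proj, t • v.snd⟩ : TM E M)) 1 (1 : ℝ)

/-- `S` is homogeneous of degree `m`: `[C, S] = (m - 1) S`. -/
def Spray.IsHomogeneous (S : Spray E M) (m : ℝ) : Prop :=
  ∀ v : TM E M,
    VectorField.mlieBracket 𝓘(ℝ, E).tangent (euler (E := E) (M := M)) S.field v
      = (m - 1) • S.field v

variable (E M) in
/-- `Spr_m(M)`, the sprays on `M` that are homogeneous of degree `m`. -/
def HomSpray (m : ℝ) : Type _ := {S : Spray E M // S.IsHomogeneous m}

/-- The natural lift `ċ` of a curve `c` in `M` to `TM`. -/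
def lift (E : Type*) [NormedAddCommGroup E] [NormedSpace ℝ E]
    {M : Type*} [TopologicalSpace M] [ChartedSpace E M] (c : ℝ → M) (t : ℝ) : TM E M :=
  ⟨c t, mfderiv 𝓘(ℝ, ℝ) 𝓘(ℝ, E) c t (1 : ℝ)⟩

/-- `c` is an `S`-geodesic on the open interval `J` (possibly unbounded): the natural lift of `c` is
an integral curve of `S` on `J`. The values of `c` outside `J` are irrelevant. -/
def Spray.IsGeodesicOn (S : Spray E M) (c : ℝ → M) (J : Set ℝ) : Prop :=
  IsOpen J ∧ J.OrdConnected ∧ J.Nonempty ∧ IsMIntegralCurveOn (lift E c) S.field J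

/-- The geodesic `c` on `J` is inextendible: it has no extension to a larger open interval. -/
def Spray.IsInextendibleGeodesicOn (S : Spray E M) (c : ℝ → M) (J : Set ℝ) : Prop :=
  S.IsGeodesicOn c J ∧
    ∀ (c' : ℝ → M) (J' : Set ℝ), S.IsGeodesicOn c' J' → J ⊆ J' → EqOn c' c J → J' = J

/-- `S` is pseudoconvex: for each compact `K` there is a compact `K'` containing every `S`-geodesic
segment with both endpoints in `K`. -/
def Spray.IsPseudoconvex (S : Spray E M) : Prop :=
  ∀ K : Set M, IsCompact K → ∃ K' : Set M, IsCompact K' ∧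
    ∀ (c : ℝ → M) (J : Set ℝ), S.IsGeodesicOn c J →
      ∀ a ∈ J, ∀ b ∈ J, a ≤ b → c a ∈ K → c b ∈ K → ∀ t ∈ Icc a b, c t ∈ K'

/-- `S` is disprisoning: no inextendible (nonconstant) `S`-geodesic is contained in a compact set.
Constant curves are geodesics of every quadratic spray, so they have to be left out. -/
def Spray.IsDisprisoning (S : Spray E M) : Prop :=
  ∀ (c : ℝ → M) (J : Set ℝ), S.IsInextendibleGeodesicOn c J → (¬ ∃ p, ∀ t ∈ J, c t = p) →
    ¬ ∃ K : Set M, IsCompact K ∧ ∀ t ∈ J, c t ∈ K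

/-- The unit sphere bundle `UM` of a Riemannian metric `h` on `M`. -/
def unitBundle (h : ContMDiffRiemannianMetric 𝓘(ℝ, E) ∞ E (fun x : M => TangentSpace 𝓘(ℝ, E) x)) :
    Set (TM E M) :=
  {u | h.inner u.proj u.snd u.snd = 1}

/-- The `C^0`-fine (Whitney) topology on `Spr_m(M)`: it is generated by the sets of all `S` whose
restriction to `UM`, as a section of `TTM` over `UM`, has its graph in a given open subset of
`TTM`. (These sets are stable under finite intersections, hence form a basis.) -/
@[reducible] def fineTopology (m : ℝ)
    (h : ContMDiffRiemannianMetric 𝓘(ℝ, E) ∞ E (fun x : M => TangentSpace 𝓘(ℝ, E) x)) :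
    TopologicalSpace (HomSpray E M m) :=
  TopologicalSpace.generateFrom
    {W | ∃ O : Set (TTM E M), IsOpen O ∧
      W = {S | ∀ u ∈ unitBundle h, (⟨u, S.1.field u⟩ : TTM E M) ∈ O}}

end Spr

end

/-!
Write `X = TM`. The bracket condition `[C, S] = (m - 1) S` is an Euler equation along rays
(`Spray.hasDerivAt_coord_scale`). Unless `M` is a point it forces `m = 2`, and it makes the field
homogeneous: multiplication by `c > 0` in the fibres carries integral curves to integral curves, run
`c` times as fast (`Spray.IsHomogeneous.isScaling`, `IsCurveFrom.scale`). So a curve from a nonzero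
vector may always be restarted from a unit vector, closeness of two sprays on unit vectors is
locally uniform closeness on all nonzero vectors (`locallyConverges_nearOver`), and the unit vectors
over a compact set form a compact set (`isCompact_unitBundle_inter`).

Perturbation arguments are limits along ultrafilters of sprays. They rest on continuous dependence
of integral curves on the field and the initial point (`tendsto_of_locallyConverges`, by Gronwall in
charts) and on lower semicontinuity of the domains of maximal curves
(`eventually_mem_of_locallyConverges`).

A curve that stays over a compact set `L` in the future produces a limit direction whose maximal
curve stays over `L` for all times (`escapes_of_not_traps`); hence, for a disprisoning spray, every
nonconstant curve leaves `L` in both directions. This implies the two local statements over a compact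
set `L`, for all sprays near `S` over `L`: no curve is trapped in `L` (`eventually_not_traps`), and
segments in `L` with endpoints in a given closed set `A` stay in a given open set that contains all
segments of `S` with endpoints in `A` (`eventually_proj_mem_of_segment`).

To globalize, exhaust `M` by compact sets `K n` such that segments of `S` with endpoints in `K n` stay
in the interior of `K (n + 1)`, and apply the local statements to the shells
`K (n + 2) \ interior (K n)`. These are locally finite, so all the conditions together hold on a set
that is open in the fine topology (`exists_isOpen_fineTopology`). For a spray in it, a segment with
endpoints in `K n` is brought into `K (n + 1)` by descending through the exhaustion and cutting at the
last exit from each member (`ShellConvex.segment`). A curve over a compact set eventually stays in a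
single shell, by convexity, and that is excluded (`ShellConvex.escapes`).
-/

section

open Filter Metric

noncomputable section

namespace Spr

/-! ### Vector fields in charts -/

section

section ODE

variable {F : Type*} [NormedAddCommGroup F] [NormedSpace ℝ F]
  {H : Type*} [TopologicalSpace H] {I : ModelWithCorners ℝ F H}
  {X : Type*} [TopologicalSpace X] [ChartedSpace H X]

section Chart

variable [IsManifold I 1 X]

variable (I) in
/-- The value at `q` of the vector field `w`, read in the preferred chart at `p`. It is meaningful
when `q` lies in the domain of that chart. -/
def fieldInChart (p : X) (w : (x : X) → TangentSpace I x) (q : X) : F :=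
  tangentCoordChange I q p q (w q)

theorem fieldInChart_self (p : X) (w : (x : X) → TangentSpace I x) :
    fieldInChart I p w p = w p :=
  tangentCoordChange_self (mem_extChartAt_source p)

theorem fieldInChart_neg (p : X) (w : (x : X) → TangentSpace I x) (q : X) :
    fieldInChart I p (-w) q = -fieldInChart I p w q :=
  map_neg (tangentCoordChange I q p q) (w q)

theorem hasDerivWithinAt_extChartAt_comp {γ : ℝ → X} {w : (x : X) → TangentSpace I x} {s : Set ℝ}
    (hγ : IsMIntegralCurveOn γ w s) {t : ℝ} (ht : t ∈ s) {p : X}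
    (hsrc : γ t ∈ (extChartAt I p).source) :
    HasDerivWithinAt (extChartAt I p ∘ γ) (fieldInChart I p w (γ t)) s t := by
  replace hsrc := extChartAt_source I p ▸ hsrc
  let D : F →L[ℝ] F := tangentCoordChange I (γ t) p (γ t)
  have hφ : HasMFDerivAt I 𝓘(ℝ, F) (extChartAt I p) (γ t) D :=
    (hasMFDerivAt_extChartAt hsrc).congr_mfderiv (mfderiv_chartAt_eq_tangentCoordChange hsrc)
  let y : F := w (γ t)
  have h : HasFDerivWithinAt (extChartAt I p ∘ γ)
      (D.comp ((1 : ℝ →L[ℝ] ℝ).smulRight y)) s t :=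
    hasMFDerivWithinAt_iff_hasFDerivWithinAt.1 (hφ.comp_hasMFDerivWithinAt t (hγ t ht))
  exact h.hasDerivWithinAt.congr_deriv (congrArg D (one_smul ℝ y))

/-- A `C¹` vector field is `C¹` when read in a chart. -/
theorem contDiffAt_fieldInChart [I.Boundaryless] {v : (x : X) → TangentSpace I x} {p : X}
    (hv : ContMDiffAt I I.tangent 1 (fun x => (⟨x, v x⟩ : TangentBundle I X)) p) :
    ContDiffAt ℝ 1 (fun z => fieldInChart I p v ((extChartAt I p).symm z)) (extChartAt I p p) := by
  rw [contMDiffAt_iff] at hv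
  exact (hv.2.contDiffAt (by simp [I.range_eq_univ])).snd

/-- A curve in the image of a chart solving the equation read in the chart is an integral curve. -/
theorem hasMFDerivAt_extChartAt_symm_comp [I.Boundaryless] {v : (x : X) → TangentSpace I x} {p : X}
    {f : ℝ → F} {t : ℝ} (hf : f t ∈ (extChartAt I p).target)
    (h : HasDerivAt f (fieldInChart I p v ((extChartAt I p).symm (f t))) t) :
    HasMFDerivAt 𝓘(ℝ, ℝ) I ((extChartAt I p).symm ∘ f) t
      ((1 : ℝ →L[ℝ] ℝ).smulRight (v ((extChartAt I p).symm (f t)))) := by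
  set q : X := (extChartAt I p).symm (f t) with hq
  have h1 : q ∈ (extChartAt I p).source := (extChartAt I p).map_target hf
  have h2 := mem_extChartAt_source (I := I) q
  have h3 := hasFDerivWithinAt_tangentCoordChange (I := I) (x := p) (y := q) (z := q) ⟨h1, h2⟩
  rw [I.range_eq_univ, hasFDerivWithinAt_univ, hq, (extChartAt I p).right_inv hf] at h3
  have h4 := h3.comp_hasDerivAt t h
  have h5 : tangentCoordChange I p q q (fieldInChart I p v q) = v q :=
    (tangentCoordChange_comp (w := q) (x := p) (y := q) ⟨⟨h2, h1⟩, h2⟩).trans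
      (tangentCoordChange_self h2)
  refine ⟨(continuousAt_extChartAt_symm'' hf).comp h.continuousAt,
    ((h4.congr_deriv h5).hasFDerivAt.hasFDerivWithinAt)⟩

end Chart

/-- A curve that starts in a closed set `C`, and that is in `C` at each time up to which it has
stayed in a neighbourhood `U` of `C`, never leaves `C`. -/
theorem forall_mem_Icc_of_bootstrap {f : ℝ → X} {a b : ℝ} (hf : ContinuousOn f (Icc a b))
    {C U : Set X} (hC : IsClosed C) (hU : IsOpen U) (hCU : C ⊆ U) (ha : f a ∈ C)
    (h : ∀ t ∈ Icc a b, (∀ s ∈ Icc a t, f s ∈ U) → f t ∈ C) : ∀ t ∈ Icc a b, f t ∈ C := by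
  by_contra! hcon
  obtain ⟨t₀, ht₀, hft₀⟩ := hcon
  set B : Set ℝ := {t | t ∈ Icc a b ∧ f t ∉ C} with hB
  have hBne : B.Nonempty := ⟨t₀, ht₀, hft₀⟩
  have hBbd : BddBelow B := ⟨a, fun t ht => ht.1.1⟩
  set τ := sInf B with hτ
  have haτ : a ≤ τ := le_csInf hBne fun t ht => ht.1.1
  have hτb : τ ≤ b := (csInf_le hBbd ⟨ht₀, hft₀⟩).trans ht₀.2
  have hlt : Ico a τ ⊆ Icc a b ∩ f ⁻¹' C := fun s hs =>
    ⟨⟨hs.1, hs.2.le.trans hτb⟩, by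
      by_contra h1
      exact not_le.2 hs.2 (csInf_le hBbd ⟨⟨hs.1, hs.2.le.trans hτb⟩, h1⟩)⟩
  have hfτ : f τ ∈ C := by
    rcases haτ.eq_or_lt with h1 | h1
    · rwa [← h1]
    · have h2 := (hf.preimage_isClosed_of_isClosed isClosed_Icc hC).closure_subset_iff.2 hlt
      rw [closure_Ico h1.ne] at h2
      exact (h2 ⟨haτ, le_rfl⟩).2
  obtain ⟨ε, hε, hεU⟩ := Metric.mem_nhdsWithin_iff.1
    (hf τ ⟨haτ, hτb⟩ (hU.mem_nhds (hCU hfτ)))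
  obtain ⟨t, htB, htε⟩ := exists_lt_of_csInf_lt hBne (show sInf B < τ + ε by linarith)
  refine htB.2 (h t htB.1 fun s hs => ?_)
  rcases lt_or_ge s τ with h1 | h1
  · exact hCU (hlt ⟨hs.1, h1⟩).2
  · refine hεU ⟨?_, hs.1, hs.2.trans htB.1.2⟩
    rw [Metric.mem_ball, Real.dist_eq, abs_of_nonneg (by linarith)]
    linarith [hs.2]

end ODE

end

/-! ### Gronwall estimates and local convergence of vector fields -/

section

section ODE

variable {F : Type*} [NormedAddCommGroup F] [NormedSpace ℝ F]
  {H : Type*} [TopologicalSpace H] {I : ModelWithCorners ℝ F H}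
  {X : Type*} [TopologicalSpace X] [ChartedSpace H X]

theorem tendsto_gronwallBound {ι : Type*} {l : Filter ι} {δ ε x : ι → ℝ} (K : ℝ) {x₀ : ℝ}
    (hδ : Tendsto δ l (𝓝 0)) (hε : Tendsto ε l (𝓝 0)) (hx : Tendsto x l (𝓝 x₀)) :
    Tendsto (fun i => gronwallBound (δ i) K (ε i) (x i)) l (𝓝 0) := by
  by_cases hK : K = 0
  · simp only [hK, gronwallBound_K0]
    simpa using hδ.add (hε.mul hx)
  · simp only [gronwallBound_of_K_ne_0 hK]
    have h1 : Tendsto (fun i => Real.exp (K * x i)) l (𝓝 (Real.exp (K * x₀))) :=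
      (Real.continuous_exp.tendsto _).comp (hx.const_mul K)
    simpa using (hδ.mul h1).add ((hε.div_const K).mul (h1.sub_const 1))

variable [IsManifold I 1 X]

variable (I) in
/-- The vector fields `w i` converge along `l` to `v`, uniformly on a neighbourhood in `A` of each
point of `P` with respect to the chart at that point. -/
def LocallyConverges {ι : Type*} (w : ι → (x : X) → TangentSpace I x)
    (v : (x : X) → TangentSpace I x) (l : Filter ι) (A P : Set X) : Prop :=
  ∀ p ∈ P, ∃ V ∈ 𝓝 p,
    TendstoUniformlyOn (fun i => fieldInChart I p (w i)) (fieldInChart I p v) l (V ∩ A)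

theorem LocallyConverges.neg {ι : Type*} {w : ι → (x : X) → TangentSpace I x}
    {v : (x : X) → TangentSpace I x} {l : Filter ι} {A P : Set X}
    (h : LocallyConverges I w v l A P) : LocallyConverges I (fun i => -w i) (-v) l A P := by
  intro p hp
  obtain ⟨V, hV, h1⟩ := h p hp
  refine ⟨V, hV, ?_⟩
  rw [Metric.tendstoUniformlyOn_iff] at h1 ⊢
  refine fun ε hε => (h1 ε hε).mono fun i hi x hx => ?_
  rw [fieldInChart_neg, fieldInChart_neg, dist_neg_neg]
  exact hi x hx

theorem locallyConverges_const {ι : Type*} (v : (x : X) → TangentSpace I x) (l : Filter ι)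
    (A P : Set X) : LocallyConverges I (fun _ : ι => v) v l A P := by
  intro p _
  refine ⟨univ, univ_mem, fun u hu => Eventually.of_forall fun i x _ => refl_mem_uniformity hu⟩

variable [I.Boundaryless] [T2Space X] [FiniteDimensional ℝ F]

/-- Continuous dependence of integral curves on the initial point and on the vector field, within
one chart. -/
theorem exists_nhds_tendsto_of_locallyConverges {ι : Type*} {l : Filter ι}
    {w : ι → (x : X) → TangentSpace I x} {v : (x : X) → TangentSpace I x} {A P : Set X}
    (hv : ContMDiff I I.tangent 1 (fun x => (⟨x, v x⟩ : TangentBundle I X)))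
    (hw : LocallyConverges I w v l A P) {p : X} (hp : p ∈ P) :
    ∃ N ∈ 𝓝 p, ∀ (γ₀ : ℝ → X) (a b : ℝ), IsMIntegralCurveOn γ₀ v (Icc a b) →
      (∀ t ∈ Icc a b, γ₀ t ∈ N) →
      ∀ (γ : ι → ℝ → X) (σ τ : ι → ℝ) (s t : ℝ),
        (∀ᶠ i in l, a ≤ σ i ∧ σ i ≤ τ i ∧ τ i ≤ b ∧ IsMIntegralCurveOn (γ i) (w i) (Icc (σ i) (τ i))
          ∧ ∀ r ∈ Icc (σ i) (τ i), γ i r ∈ A) →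
        s ∈ Icc a b → t ∈ Icc a b →
        Tendsto σ l (𝓝 s) → Tendsto τ l (𝓝 t) → Tendsto (fun i => γ i (σ i)) l (𝓝 (γ₀ s)) →
        Tendsto (fun i => γ i (τ i)) l (𝓝 (γ₀ t)) := by
  obtain ⟨V, hV, hconv⟩ := hw p hp
  set φ := extChartAt I p with hφ
  obtain ⟨K, S, hS, hlip⟩ := (contDiffAt_fieldInChart (hv.contMDiffAt (x := p))).exists_lipschitzOnWith
  -- a closed ball in the chart on which the limit field is Lipschitz and the convergence is uniform
  obtain ⟨R, hR, hRS⟩ : ∃ R > 0, closedBall (φ p) R ⊆ S ∩ φ.target ∩ φ.symm ⁻¹' V := by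
    refine (nhds_basis_closedBall.mem_iff).1 (inter_mem (inter_mem hS ?_) ?_)
    · exact extChartAt_target_mem_nhds p
    · refine (continuousAt_extChartAt_symm p).preimage_mem_nhds ?_
      simpa [hφ] using hV
  set Cs : ℝ → Set X := fun r => φ.symm '' closedBall (φ p) r with hCs
  have hmemCs : ∀ r ≤ R, ∀ x, x ∈ Cs r ↔ x ∈ φ.source ∧ φ x ∈ closedBall (φ p) r := by
    intro r hr x
    have hsub : closedBall (φ p) r ⊆ φ.target :=
      (closedBall_subset_closedBall hr).trans fun z hz => (hRS hz).1.2
    constructor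
    · rintro ⟨z, hz, rfl⟩
      exact ⟨φ.map_target (hsub hz), by rwa [φ.right_inv (hsub hz)]⟩
    · rintro ⟨h1, h2⟩
      exact ⟨φ x, h2, φ.left_inv h1⟩
  have hclosed : ∀ r ≤ R, IsClosed (Cs r) := by
    intro r hr
    have : ProperSpace F := FiniteDimensional.proper_real F
    refine (IsCompact.image_of_continuousOn (isCompact_closedBall _ _) ?_).isClosed
    exact (continuousOn_extChartAt_symm p).mono fun z hz =>
      (hRS (closedBall_subset_closedBall hr hz)).1.2
  set U : Set X := φ.source ∩ φ ⁻¹' ball (φ p) R with hU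
  have hUo : IsOpen U :=
    (continuousOn_extChartAt p).isOpen_inter_preimage (isOpen_extChartAt_source p) isOpen_ball
  refine ⟨φ.source ∩ φ ⁻¹' closedBall (φ p) (R / 4), ?_, ?_⟩
  · exact inter_mem (extChartAt_source_mem_nhds p)
      ((continuousAt_extChartAt p).preimage_mem_nhds (closedBall_mem_nhds _ (by positivity)))
  intro γ₀ a b hγ₀ hN γ σ τ s t hev hs ht hσ hτ hstart
  set g : ℝ → F := φ ∘ γ₀ with hg
  have hgd : ∀ r ∈ Icc a b, HasDerivWithinAt g (fieldInChart I p v (γ₀ r)) (Icc a b) r :=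
    fun r hr => hasDerivWithinAt_extChartAt_comp hγ₀ hr (hN r hr).1
  have hgc : ContinuousOn g (Icc a b) := fun r hr => (hgd r hr).continuousWithinAt
  -- initial distance in the chart
  set δ : ι → ℝ := fun i => dist (φ (γ i (σ i))) (g (σ i)) with hδ
  have hσ' : Tendsto σ l (𝓝[Icc a b] s) := tendsto_nhdsWithin_iff.2
    ⟨hσ, hev.mono fun i hi => ⟨hi.1, hi.2.1.trans hi.2.2.1⟩⟩
  have hτ' : Tendsto τ l (𝓝[Icc a b] t) := tendsto_nhdsWithin_iff.2
    ⟨hτ, hev.mono fun i hi => ⟨hi.1.trans hi.2.1, hi.2.2.1⟩⟩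
  have hφs : Tendsto (fun i => φ (γ i (σ i))) l (𝓝 (g s)) :=
    (continuousAt_extChartAt' (hN s hs).1).tendsto.comp hstart
  have hδ0 : Tendsto δ l (𝓝 0) := by
    have := hφs.dist ((hgc s hs).tendsto.comp hσ')
    simpa using this
  have hsrc : ∀ᶠ i in l, γ i (σ i) ∈ φ.source :=
    hstart.eventually ((isOpen_extChartAt_source p).mem_nhds (hN s hs).1)
  -- the comparison, for an error bound `ε` in the equation
  have key : ∀ ε > 0, ∀ᶠ i in l, gronwallBound (δ i) K ε (b - a) < R / 4 →
      γ i (τ i) ∈ φ.source ∧ dist (φ (γ i (τ i))) (g (τ i)) ≤ gronwallBound (δ i) K ε (b - a) := by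
    intro ε hε
    filter_upwards [hev, hsrc, Metric.tendstoUniformlyOn_iff.1 hconv ε hε] with i hi hsi hci hlt
    obtain ⟨hσa, hστ, hτb, hγi, hA⟩ := hi
    have hδi : 0 ≤ δ i := dist_nonneg
    have hK : (0 : ℝ) ≤ K := K.2
    -- comparison up to any time before which the curve stays in `U`
    have cmp : ∀ r ∈ Icc (σ i) (τ i), (∀ q ∈ Icc (σ i) r, γ i q ∈ U) →
        dist (φ (γ i r)) (g r) ≤ gronwallBound (δ i) K ε (b - a) := by
      intro r hr hq
      have hsubI : Icc (σ i) r ⊆ Icc (σ i) (τ i) := Icc_subset_Icc_right hr.2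
      have hsubA : Icc (σ i) r ⊆ Icc a b := Icc_subset_Icc hσa (hr.2.trans hτb)
      have hd1 : ∀ q ∈ Icc (σ i) r, HasDerivWithinAt (φ ∘ γ i)
          (fieldInChart I p (w i) (γ i q)) (Icc (σ i) r) q := fun q hqm =>
        hasDerivWithinAt_extChartAt_comp (hγi.mono hsubI) hqm (hq q hqm).1
      have hnh : ∀ q ∈ Ico (σ i) r, Icc (σ i) r ∈ 𝓝[≥] q := fun q hq =>
        Icc_mem_nhdsGE_of_mem hq
      have := dist_le_of_approx_trajectories_ODE_of_mem (K := K) (εf := ε) (εg := 0) (δ := δ i)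
        (v := fun _ z => fieldInChart I p v (φ.symm z)) (s := fun _ => closedBall (φ p) R)
        (f := φ ∘ γ i) (g := g) (a := σ i) (b := r)
        (f' := fun q => fieldInChart I p (w i) (γ i q)) (g' := fun q => fieldInChart I p v (γ₀ q))
        (fun _ _ => hlip.mono fun z hz => (hRS hz).1.1)
        (fun q hqm => (hd1 q hqm).continuousWithinAt)
        (fun q hqm => (hd1 q (Ico_subset_Icc_self hqm)).mono_of_mem_nhdsWithin (hnh q hqm))
        (fun q hqm => by
          have hqm' := Ico_subset_Icc_self hqm
          have h1 := hq q hqm'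
          have h2 : γ i q ∈ V := by
            have := (hRS (ball_subset_closedBall h1.2)).2
            rwa [mem_preimage, φ.left_inv h1.1] at this
          have h3 := hci (γ i q) ⟨h2, hA q (hsubI hqm')⟩
          simp only [Function.comp_apply, φ.left_inv h1.1]
          rw [dist_comm]; exact h3.le)
        (fun q hqm => ball_subset_closedBall (hq q (Ico_subset_Icc_self hqm)).2)
        (hgc.mono hsubA)
        (fun q hqm => ((hgd q (hsubA (Ico_subset_Icc_self hqm))).mono hsubA).mono_of_mem_nhdsWithin
          (hnh q hqm))
        (fun q hqm => by
          simp only [hg, Function.comp_apply, φ.left_inv (hN q (hsubA (Ico_subset_Icc_self hqm))).1]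
          simp)
        (fun q hqm => closedBall_subset_closedBall (by linarith)
          (hN q (hsubA (Ico_subset_Icc_self hqm))).2)
        le_rfl r ⟨hr.1, le_rfl⟩
      refine this.trans ?_
      rw [add_zero]
      refine gronwallBound_mono hδi hε.le hK ?_
      linarith [hr.2]
    have hinC : ∀ r ∈ Icc (σ i) (τ i), γ i r ∈ U →
        dist (φ (γ i r)) (g r) ≤ gronwallBound (δ i) K ε (b - a) → γ i r ∈ Cs (R / 2) := by
      intro r hr h1 h2
      rw [hmemCs _ (by linarith)]
      refine ⟨h1.1, ?_⟩
      have h3 : dist (g r) (φ p) ≤ R / 4 := (hN r ⟨hσa.trans hr.1, hr.2.trans hτb⟩).2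
      rw [mem_closedBall]
      exact (dist_triangle _ (g r) _).trans (by linarith)
    have h0 : dist (φ (γ i (σ i))) (g (σ i)) ≤ gronwallBound (δ i) K ε (b - a) := by
      calc dist (φ (γ i (σ i))) (g (σ i)) = gronwallBound (δ i) K ε 0 := by
            rw [gronwallBound_x0]
        _ ≤ _ := gronwallBound_mono hδi hε.le hK (by linarith)
    have hU0 : γ i (σ i) ∈ U := by
      refine ⟨hsi, ?_⟩
      have h3 : dist (g (σ i)) (φ p) ≤ R / 4 := (hN (σ i) ⟨hσa, hστ.trans hτb⟩).2
      rw [mem_preimage, mem_ball]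
      exact (dist_triangle _ (g (σ i)) _).trans_lt (by linarith)
    have hCU : Cs (R / 2) ⊆ U := fun x hx => by
      rw [hmemCs _ (by linarith)] at hx
      exact ⟨hx.1, closedBall_subset_ball (by linarith) hx.2⟩
    have hall := forall_mem_Icc_of_bootstrap hγi.continuousOn (hclosed (R / 2) (by linarith)) hUo
      hCU (hinC _ ⟨le_rfl, hστ⟩ hU0 h0)
      (fun r hr hq => hinC r hr (hq r ⟨hr.1, le_rfl⟩) (cmp r hr hq))
    exact ⟨(hCU (hall _ ⟨hστ, le_rfl⟩)).1, cmp _ ⟨hστ, le_rfl⟩ fun q hq => hCU (hall q hq)⟩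
  -- the error bound is arbitrarily small, as the initial distance tends to zero
  have hsmall : ∀ η > 0, ∃ ε > 0, ∀ᶠ i in l, gronwallBound (δ i) K ε (b - a) < η := by
    intro η hη
    have h1 : ∀ᶠ z : ℝ × ℝ in 𝓝 0 ×ˢ 𝓝 0, gronwallBound z.1 K z.2 (b - a) < η :=
      (tendsto_gronwallBound (K : ℝ) tendsto_fst tendsto_snd
        (tendsto_const_nhds (x := b - a))).eventually (gt_mem_nhds hη)
    obtain ⟨pa, hpa, pb, hpb, h2⟩ := eventually_prod_iff.1 h1
    obtain ⟨ε, hε, hε2⟩ := Metric.eventually_nhds_iff.1 hpb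
    refine ⟨ε / 2, by positivity, (hδ0.eventually hpa).mono fun i hi => h2 hi (hε2 ?_)⟩
    rw [Real.dist_eq, sub_zero, abs_of_pos (by positivity)]; linarith
  have hsrcτ : ∀ᶠ i in l, γ i (τ i) ∈ φ.source := by
    obtain ⟨ε, hε, h1⟩ := hsmall (R / 4) (by positivity)
    filter_upwards [h1, key ε hε] with i h2 h3 using (h3 h2).1
  have hdist : Tendsto (fun i => dist (φ (γ i (τ i))) (g (τ i))) l (𝓝 0) := by
    rw [Metric.tendsto_nhds]
    intro η hη
    obtain ⟨ε, hε, h1⟩ := hsmall (min η (R / 4)) (by positivity)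
    filter_upwards [h1, key ε hε] with i h2 h3
    rw [Real.dist_eq, sub_zero, abs_of_nonneg dist_nonneg]
    exact ((h3 (h2.trans_le (min_le_right _ _))).2).trans_lt (h2.trans_le (min_le_left _ _))
  have hlim : Tendsto (fun i => φ (γ i (τ i))) l (𝓝 (g t)) :=
    (tendsto_iff_of_dist (by simpa [dist_comm] using hdist)).1 ((hgc t ht).tendsto.comp hτ')
  have hback : Tendsto (fun i => φ.symm (φ (γ i (τ i)))) l (𝓝 (γ₀ t)) := by
    have h1 := (continuousAt_extChartAt_symm' (hN t ht).1).tendsto.comp hlim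
    rwa [φ.left_inv (hN t ht).1] at h1
  exact hback.congr' (hsrcτ.mono fun i hi => φ.left_inv hi)

end ODE

end

/-! ### Integral curves and their maximal domains -/

section

section ODE

variable {F : Type*} [NormedAddCommGroup F] [NormedSpace ℝ F]
  {H : Type*} [TopologicalSpace H] {I : ModelWithCorners ℝ F H}
  {X : Type*} [TopologicalSpace X] [ChartedSpace H X]

/-- `γ` is an integral curve of `v` on the open interval `J`, which contains `0`, and `γ 0 = u`. The
values of `γ` outside `J` are irrelevant. -/
structure IsCurveFrom (v : (x : X) → TangentSpace I x) (u : X) (γ : ℝ → X) (J : Set ℝ) : Prop where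
  isOpen : IsOpen J
  ordConnected : J.OrdConnected
  zero_mem : (0 : ℝ) ∈ J
  curve : IsMIntegralCurveOn γ v J
  map_zero : γ 0 = u

/-- `γ` is an integral curve of `v` from `u` on `J` that cannot be continued to the right: no
integral curve from `u` is defined at a nonnegative time outside `J`. -/
structure IsForwardMaximal (v : (x : X) → TangentSpace I x) (u : X) (γ : ℝ → X) (J : Set ℝ) : Prop
    extends IsCurveFrom v u γ J where
  maximal : ∀ γ' J', IsCurveFrom v u γ' J' → ∀ t ∈ J', 0 ≤ t → t ∈ J

theorem IsCurveFrom.Icc_subset {v : (x : X) → TangentSpace I x} {u : X} {γ : ℝ → X} {J : Set ℝ}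
    (h : IsCurveFrom v u γ J) {t : ℝ} (ht : t ∈ J) : Icc 0 t ⊆ J :=
  h.ordConnected.out h.zero_mem ht

theorem exists_Ioo_subset_of_ordConnected {J : Set ℝ} (hJ : IsOpen J) (hJc : J.OrdConnected)
    {s t : ℝ} (hs : s ∈ J) (ht : t ∈ J) :
    ∃ a b, s ∈ Ioo a b ∧ t ∈ Ioo a b ∧ Ioo a b ⊆ J := by
  obtain ⟨ε₁, h1, h2⟩ := Metric.isOpen_iff.1 hJ s hs
  obtain ⟨ε₂, h3, h4⟩ := Metric.isOpen_iff.1 hJ t ht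
  rw [Real.ball_eq_Ioo] at h2 h4
  refine ⟨min (s - ε₁) (t - ε₂), max (s + ε₁) (t + ε₂), ?_, ?_, ?_⟩
  · exact ⟨(min_le_left _ _).trans_lt (by linarith), lt_of_lt_of_le (by linarith) (le_max_left _ _)⟩
  · exact ⟨(min_le_right _ _).trans_lt (by linarith),
      lt_of_lt_of_le (by linarith) (le_max_right _ _)⟩
  · rintro r ⟨hr1, hr2⟩
    rw [min_lt_iff] at hr1
    rw [lt_max_iff] at hr2
    have hlow : ∃ x ∈ J, x ≤ r := by
      by_contra! hc
      rcases hr1 with h | h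
      · exact absurd (hc r (h2 ⟨h, (hc s hs).trans (by linarith)⟩)) (lt_irrefl _)
      · exact absurd (hc r (h4 ⟨h, (hc t ht).trans (by linarith)⟩)) (lt_irrefl _)
    have hup : ∃ x ∈ J, r ≤ x := by
      by_contra! hc
      rcases hr2 with h | h
      · exact absurd (hc r (h2 ⟨by linarith [hc s hs], h⟩)) (lt_irrefl _)
      · exact absurd (hc r (h4 ⟨by linarith [hc t ht], h⟩)) (lt_irrefl _)
    obtain ⟨x, hx, hxr⟩ := hlow
    obtain ⟨y, hy, hry⟩ := hup
    exact hJc.out hx hy ⟨hxr, hry⟩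

theorem IsCurveFrom.shift {v : (x : X) → TangentSpace I x} {u : X} {γ : ℝ → X} {J : Set ℝ}
    (h : IsCurveFrom v u γ J) {τ : ℝ} (hτ : τ ∈ J) :
    IsCurveFrom v (γ τ) (fun t => γ (t + τ)) {t | t + τ ∈ J} where
  isOpen := h.isOpen.preimage (continuous_add_const τ)
  ordConnected := ⟨fun x hx y hy z hz =>
    h.ordConnected.out hx hy ⟨by linarith [hz.1], by linarith [hz.2]⟩⟩
  zero_mem := by simpa using hτ
  curve := h.curve.comp_add τ
  map_zero := by simp

/-- Reversing time turns integral curves of `v` into integral curves of `-v`. -/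
theorem IsCurveFrom.reverse {v : (x : X) → TangentSpace I x} {u : X} {γ : ℝ → X} {J : Set ℝ}
    (h : IsCurveFrom v u γ J) : IsCurveFrom (-v) u (fun t => γ (-t)) {t | -t ∈ J} where
  isOpen := h.isOpen.preimage continuous_neg
  ordConnected := ⟨fun x hx y hy z hz =>
    h.ordConnected.out hy hx ⟨by linarith [hz.2], by linarith [hz.1]⟩⟩
  zero_mem := by simpa using h.zero_mem
  curve := by
    have := h.curve.comp_mul (-1)
    simpa [Function.comp_def] using this
  map_zero := by simpa using h.map_zero

variable [IsManifold I 1 X] {v : (x : X) → TangentSpace I x}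

theorem contMDiff_neg_field
    (hv : ContMDiff I I.tangent 1 (fun x => (⟨x, v x⟩ : TangentBundle I X))) :
    ContMDiff I I.tangent 1 (fun x => (⟨x, (-v) x⟩ : TangentBundle I X)) := by
  intro x
  have h := hv x
  rw [Bundle.contMDiffAt_section] at h ⊢
  have h' := h.neg
  refine h'.congr_of_eventuallyEq ?_
  filter_upwards [(trivializationAt F (TangentSpace I) x).open_baseSet.mem_nhds
    (mem_baseSet_trivializationAt F (TangentSpace I) x)] with y hy
  exact ((trivializationAt F (TangentSpace I) x).linear ℝ hy).map_neg (v y)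

variable [I.Boundaryless] [T2Space X]

theorem IsCurveFrom.eqOn {u : X} {γ₁ γ₂ : ℝ → X} {J₁ J₂ : Set ℝ}
    (hv : ContMDiff I I.tangent 1 (fun x => (⟨x, v x⟩ : TangentBundle I X)))
    (h₁ : IsCurveFrom v u γ₁ J₁) (h₂ : IsCurveFrom v u γ₂ J₂) : EqOn γ₁ γ₂ (J₁ ∩ J₂) := by
  rintro t ht
  obtain ⟨a, b, h0, ht', hsub⟩ := exists_Ioo_subset_of_ordConnected (h₁.isOpen.inter h₂.isOpen)
    (h₁.ordConnected.inter h₂.ordConnected) ⟨h₁.zero_mem, h₂.zero_mem⟩ ht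
  exact isMIntegralCurveOn_Ioo_eqOn_of_contMDiff_boundaryless h0 hv
    (h₁.curve.mono (hsub.trans inter_subset_left)) (h₂.curve.mono (hsub.trans inter_subset_right))
    (h₁.map_zero.trans h₂.map_zero.symm) ht'

variable [FiniteDimensional ℝ F]

/-- Each point is the origin of an integral curve whose domain contains the domain of every other
one: the union of all integral curves from that point. -/
theorem exists_maximal_isCurveFrom
    (hv : ContMDiff I I.tangent 1 (fun x => (⟨x, v x⟩ : TangentBundle I X))) (u : X) :
    ∃ γ J, IsCurveFrom v u γ J ∧ ∀ γ' J', IsCurveFrom v u γ' J' → J' ⊆ J := by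
  have hex : ∃ γ J, IsCurveFrom v u γ J := by
    obtain ⟨γ, h0, h⟩ := exists_isMIntegralCurveAt_of_contMDiffAt_boundaryless 0
      (hv.contMDiffAt (x := u))
    obtain ⟨ε, hε, h1⟩ := isMIntegralCurveAt_iff'.1 h
    exact ⟨γ, ball 0 ε, isOpen_ball, by rw [Real.ball_eq_Ioo]; exact ordConnected_Ioo,
      mem_ball_self hε, h1, h0⟩
  set D : Set ℝ := {t | ∃ γ J, IsCurveFrom v u γ J ∧ t ∈ J} with hD
  have : Nonempty X := ⟨u⟩
  choose! G JG hG using fun t (ht : t ∈ D) => ht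
  have hagree : ∀ γ J, IsCurveFrom v u γ J → EqOn (fun t => G t t) γ J := fun γ J h t ht =>
    (hG t ⟨γ, J, h, ht⟩).1.eqOn hv h ⟨(hG t ⟨γ, J, h, ht⟩).2, ht⟩
  refine ⟨fun t => G t t, D, ⟨?_, ?_, ?_, ?_, ?_⟩, fun γ' J' h t ht => ⟨γ', J', h, ht⟩⟩
  · rw [isOpen_iff_mem_nhds]
    rintro t ⟨γ, J, h, ht⟩
    exact mem_of_superset (h.isOpen.mem_nhds ht) fun s hs => ⟨γ, J, h, hs⟩
  · rw [ordConnected_iff_uIcc_subset]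
    rintro x ⟨γ, J, h, hx⟩ y ⟨γ', J', h', hy⟩ z hz
    rcases uIcc_subset_uIcc_union_uIcc (b := 0) hz with h1 | h1
    · exact ⟨γ, J, h, h.ordConnected.uIcc_subset hx h.zero_mem h1⟩
    · exact ⟨γ', J', h', h'.ordConnected.uIcc_subset h'.zero_mem hy h1⟩
  · obtain ⟨γ, J, h⟩ := hex
    exact ⟨γ, J, h, h.zero_mem⟩
  · refine IsMIntegralCurveAt.isMIntegralCurveOn ?_
    rintro t ⟨γ, J, h, ht⟩
    have h1 := h.curve.isMIntegralCurveAt (h.isOpen.mem_nhds ht)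
    have h2 : (fun t => G t t) =ᶠ[𝓝 t] γ :=
      mem_of_superset (h.isOpen.mem_nhds ht) (hagree γ J h)
    unfold IsMIntegralCurveAt at *
    filter_upwards [h1, h2.eventuallyEq_nhds] with s hs1 hs2
    have := hs1.congr_of_eventuallyEq hs2
    rwa [← hs2.eq_of_nhds] at this
  · obtain ⟨γ, J, h⟩ := hex
    exact (hagree γ J h h.zero_mem).trans h.map_zero

theorem exists_isForwardMaximal
    (hv : ContMDiff I I.tangent 1 (fun x => (⟨x, v x⟩ : TangentBundle I X))) (u : X) :
    ∃ γ J, IsForwardMaximal v u γ J := by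
  obtain ⟨γ, J, h, hmax⟩ := exists_maximal_isCurveFrom hv u
  exact ⟨γ, J, h, fun γ' J' h' t ht _ => hmax γ' J' h' ht⟩

/-- If a curve from `γ τ` exists on an interval, then the curve `γ` can be continued along it. -/
theorem IsForwardMaximal.add_mem {u : X} {γ : ℝ → X} {J : Set ℝ}
    (hv : ContMDiff I I.tangent 1 (fun x => (⟨x, v x⟩ : TangentBundle I X)))
    (h : IsForwardMaximal v u γ J) {τ : ℝ} (hτ : τ ∈ J) {β : ℝ → X} {J' : Set ℝ}
    (hβ : IsCurveFrom v (γ τ) β J') {δ : ℝ} (hδ : δ ∈ J') (h0 : 0 ≤ τ + δ) : τ + δ ∈ J := by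
  obtain ⟨α, D, hα, hmax⟩ := exists_maximal_isCurveFrom hv (γ τ)
  have h1 : {t | t + τ ∈ J} ⊆ D := hmax _ _ (h.shift hτ)
  have hτD : -τ ∈ D := h1 (by simpa using h.zero_mem)
  have h2 := hα.shift hτD
  have h3 : α (-τ) = u := by
    have := hα.eqOn hv (h.shift hτ) ⟨hτD, by simpa using h.zero_mem⟩
    simpa [h.map_zero] using this
  rw [h3] at h2
  refine h.maximal _ _ h2 _ ?_ h0
  simpa using hmax _ _ hβ hδ

omit [T2Space X] in
/-- The time of existence is bounded below near each point. -/
theorem exists_nhds_uniform_time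
    (hv : ContMDiff I I.tangent 1 (fun x => (⟨x, v x⟩ : TangentBundle I X))) (p : X) :
    ∃ V ∈ 𝓝 p, ∃ δ > 0, ∀ x ∈ V, ∃ γ J, IsCurveFrom v x γ J ∧ δ ∈ J := by
  set φ := extChartAt I p with hφ
  have : CompleteSpace F := FiniteDimensional.complete ℝ F
  obtain ⟨ε, hε, a, r, L, K, hr, hpl⟩ := IsPicardLindelof.of_contDiffAt_one
    (contDiffAt_fieldInChart (hv.contMDiffAt (x := p)))
  obtain ⟨α, hα, hαc⟩ :=
    (hpl 0).exists_forall_mem_closedBall_eq_hasDerivWithinAt_continuousOn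
  have hr' : (0 : ℝ) < r := hr
  -- near `(φ p, 0)` the local flow stays in the image of the chart
  have hnhds : closedBall (φ p) r ×ˢ Icc (0 - ε) (0 + ε) ∈ 𝓝 (φ p, (0 : ℝ)) :=
    prod_mem_nhds (closedBall_mem_nhds _ hr') (Icc_mem_nhds (by linarith) (by linarith))
  have hα0 : α (φ p, 0) = φ p := (hα (φ p) (mem_closedBall_self hr'.le)).1
  have htar : ∀ᶠ z in 𝓝 (φ p, (0 : ℝ)), α z ∈ φ.target := by
    refine (hαc.continuousAt hnhds).eventually ?_
    rw [hα0]
    exact extChartAt_target_mem_nhds p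
  rw [nhds_prod_eq] at htar
  obtain ⟨pa, hpa, pb, hpb, hab⟩ := eventually_prod_iff.1 htar
  obtain ⟨η, hη, hη2⟩ := Metric.eventually_nhds_iff.1 hpb
  set ρ := min ε η with hρ
  have hρ0 : 0 < ρ := lt_min hε hη
  refine ⟨φ.source ∩ φ ⁻¹' (closedBall (φ p) r ∩ {z | pa z}), ?_, ρ / 2, by positivity, ?_⟩
  · exact inter_mem (extChartAt_source_mem_nhds p)
      ((continuousAt_extChartAt p).preimage_mem_nhds (inter_mem (closedBall_mem_nhds _ hr') hpa))
  rintro x ⟨hx1, hx2, hx3⟩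
  refine ⟨φ.symm ∘ fun t => α (φ x, t), Ioo (-ρ) ρ, ⟨isOpen_Ioo, ordConnected_Ioo,
    ⟨by linarith, hρ0⟩, ?_, ?_⟩, ⟨by linarith, by linarith⟩⟩
  · intro t ht
    have ht' : t ∈ Ioo (0 - ε) (0 + ε) :=
      ⟨by linarith [ht.1, min_le_left ε η], by linarith [ht.2, min_le_left ε η]⟩
    refine (hasMFDerivAt_extChartAt_symm_comp ?_ ?_).hasMFDerivWithinAt
    · refine hab hx3 (hη2 ?_)
      rw [Real.dist_eq, sub_zero, abs_lt]
      exact ⟨by linarith [ht.1, min_le_right ε η], by linarith [ht.2, min_le_right ε η]⟩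
    · exact ((hα (φ x) hx2).2 t (Ioo_subset_Icc_self ht')).hasDerivAt (Icc_mem_nhds ht'.1 ht'.2)
  · simp only [Function.comp_apply, (hα (φ x) hx2).1]
    exact φ.left_inv hx1

theorem exists_nhds_forall_isForwardMaximal_add_mem
    (hv : ContMDiff I I.tangent 1 (fun x => (⟨x, v x⟩ : TangentBundle I X))) (p : X) :
    ∃ V ∈ 𝓝 p, ∃ δ > 0, ∀ u γ J, IsForwardMaximal v u γ J →
      ∀ τ ∈ J, 0 ≤ τ → γ τ ∈ V → τ + δ ∈ J := by
  obtain ⟨V, hV, δ, hδ, h⟩ := exists_nhds_uniform_time hv p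
  refine ⟨V, hV, δ, hδ, fun u γ J hJ τ hτ h0 hτV => ?_⟩
  obtain ⟨β, J', hβ, hδ'⟩ := h _ hτV
  exact hJ.add_mem hv hτ hβ hδ' (by linarith)

/-- An integral curve that ceases to exist in finite time leaves every compact set before. -/
theorem IsForwardMaximal.exists_notMem_of_isCompact {u : X} {γ : ℝ → X} {J : Set ℝ}
    (hv : ContMDiff I I.tangent 1 (fun x => (⟨x, v x⟩ : TangentBundle I X)))
    (h : IsForwardMaximal v u γ J) {s : ℝ} (hs : s ∉ J) (hs0 : 0 ≤ s) {N : Set X}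
    (hN : IsCompact N) : ∃ τ ∈ J, 0 ≤ τ ∧ τ ≤ s ∧ γ τ ∉ N := by
  have hunif : ∃ δ > 0, ∀ τ ∈ J, 0 ≤ τ → γ τ ∈ N → τ + δ ∈ J := by
    refine hN.induction_on (p := fun N' => ∃ δ > 0, ∀ τ ∈ J, 0 ≤ τ → γ τ ∈ N' → τ + δ ∈ J)
      ⟨1, one_pos, fun _ _ _ h => h.elim⟩ ?_ ?_ ?_
    · rintro s t hst ⟨δ, hδ, h1⟩
      exact ⟨δ, hδ, fun τ hτ h0 h2 => h1 τ hτ h0 (hst h2)⟩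
    · rintro s t ⟨δ, hδ, h1⟩ ⟨δ', hδ', h1'⟩
      refine ⟨min δ δ', lt_min hδ hδ', fun τ hτ h0 h2 => ?_⟩
      rcases h2 with h2 | h2
      · exact h.ordConnected.out hτ (h1 τ hτ h0 h2)
          ⟨by linarith [lt_min hδ hδ'], by linarith [min_le_left δ δ']⟩
      · exact h.ordConnected.out hτ (h1' τ hτ h0 h2)
          ⟨by linarith [lt_min hδ hδ'], by linarith [min_le_right δ δ']⟩
    · intro x _
      obtain ⟨V, hV, δ, hδ, h1⟩ := exists_nhds_forall_isForwardMaximal_add_mem hv x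
      exact ⟨V, mem_nhdsWithin_of_mem_nhds hV, δ, hδ, h1 u γ J h⟩
  by_contra! hcon
  obtain ⟨δ, hδ, h1⟩ := hunif
  have hJs : ∀ t ∈ J, 0 ≤ t → t ≤ s := by
    intro t ht h0
    by_contra! h2
    exact hs (h.Icc_subset ht ⟨hs0, h2.le⟩)
  have hmul : ∀ n : ℕ, n * δ ∈ J := by
    intro n
    induction n with
    | zero => simpa using h.zero_mem
    | succ n ih =>
      have h0 : 0 ≤ n * δ := by positivity
      have := h1 _ ih h0 (hcon _ ih h0 (hJs _ ih h0))
      push_cast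
      rwa [add_mul, one_mul]
  obtain ⟨n, hn⟩ := exists_nat_gt (s / δ)
  rw [div_lt_iff₀ hδ] at hn
  exact absurd (hJs _ (hmul n) (by positivity)) (not_le.2 hn)

end ODE

end

/-! ### Dependence of integral curves on the field and the initial point -/

section

section ODE

variable {F : Type*} [NormedAddCommGroup F] [NormedSpace ℝ F]
  {H : Type*} [TopologicalSpace H] {I : ModelWithCorners ℝ F H}
  {X : Type*} [TopologicalSpace X] [ChartedSpace H X]
  [IsManifold I 1 X] [I.Boundaryless] [T2Space X] [FiniteDimensional ℝ F]
  {v : (x : X) → TangentSpace I x} {ι : Type*} {w : ι → (x : X) → TangentSpace I x} {A P : Set X}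

/-- Continuous dependence of integral curves on the initial point and on the vector field. The
fields `w i` need only be close to `v` along the curves `γ i`. -/
theorem tendsto_of_locallyConverges {l : Filter ι} [l.NeBot]
    (hv : ContMDiff I I.tangent 1 (fun x => (⟨x, v x⟩ : TangentBundle I X)))
    (hw : LocallyConverges I w v l A P) {u : X} {γ₀ : ℝ → X} {J : Set ℝ}
    (hγ₀ : IsCurveFrom v u γ₀ J) (hP : ∀ t ∈ J, γ₀ t ∈ P) {γ : ι → ℝ → X} {τ : ι → ℝ}
    (hγ : ∀ᶠ i in l, 0 ≤ τ i ∧ IsMIntegralCurveOn (γ i) (w i) (Icc 0 (τ i)) ∧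
      ∀ r ∈ Icc 0 (τ i), γ i r ∈ A)
    (h0 : Tendsto (fun i => γ i 0) l (𝓝 u)) {t : ℝ} (ht : t ∈ J) (hτ : Tendsto τ l (𝓝 t)) :
    Tendsto (fun i => γ i (τ i)) l (𝓝 (γ₀ t)) := by
  have ht0 : 0 ≤ t := ge_of_tendsto hτ (hγ.mono fun i hi => hi.1)
  have hsubJ := hγ₀.Icc_subset ht
  set Q : ℝ → Prop := fun s => ∀ σ : ι → ℝ, (∀ᶠ i in l, 0 ≤ σ i ∧ σ i ≤ τ i) →
    Tendsto σ l (𝓝 s) → Tendsto (fun i => γ i (σ i)) l (𝓝 (γ₀ s)) with hQ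
  suffices hall : ∀ s ∈ Icc 0 t, Q s from
    hall t ⟨ht0, le_rfl⟩ τ (hγ.mono fun i hi => ⟨hi.1, le_rfl⟩) hτ
  by_contra! hcon
  obtain ⟨s₀, hs₀, hQs₀⟩ := hcon
  -- the infimum of the times at which convergence fails
  set B : Set ℝ := {s | s ∈ Icc 0 t ∧ ¬ Q s} with hB
  have hBne : B.Nonempty := ⟨s₀, hs₀, hQs₀⟩
  have hBbd : BddBelow B := ⟨0, fun s hs => hs.1.1⟩
  set c := sInf B with hc
  have h0c : 0 ≤ c := le_csInf hBne fun s hs => hs.1.1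
  have hct : c ≤ t := (csInf_le hBbd ⟨hs₀, hQs₀⟩).trans hs₀.2
  have hlt : ∀ s, 0 ≤ s → s < c → Q s := by
    intro s hs hsc
    by_contra h1
    exact not_le.2 hsc (csInf_le hBbd ⟨⟨hs, hsc.le.trans hct⟩, h1⟩)
  have hcJ : c ∈ J := hsubJ ⟨h0c, hct⟩
  obtain ⟨N, hN, hstep⟩ := exists_nhds_tendsto_of_locallyConverges hv hw (hP c hcJ)
  have hcont : ContinuousAt γ₀ c :=
    (hγ₀.curve.continuousOn).continuousAt (hγ₀.isOpen.mem_nhds hcJ)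
  obtain ⟨η, hη, hηN⟩ := Metric.mem_nhds_iff.1
    (inter_mem (hcont.preimage_mem_nhds hN) (hγ₀.isOpen.mem_nhds hcJ))
  have hball : ∀ r ∈ Icc (c - η / 2) (c + η / 2), γ₀ r ∈ N ∧ r ∈ J := by
    intro r hr
    refine hηN ?_
    rw [Metric.mem_ball, Real.dist_eq, abs_lt]
    constructor <;> linarith [hr.1, hr.2]
  set s₁ := max 0 (c - η / 4) with hs₁
  have hs₁c : s₁ ≤ c := max_le h0c (by linarith)
  have hs₁l : c - η / 4 ≤ s₁ := le_max_right _ _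
  -- convergence up to time `s₁`
  have hstart : ∀ σ : ι → ℝ, (∀ᶠ i in l, 0 ≤ σ i ∧ σ i ≤ τ i ∧ σ i ≤ s₁) →
      Tendsto σ l (𝓝 s₁) → Tendsto (fun i => γ i (σ i)) l (𝓝 (γ₀ s₁)) := by
    intro σ hσ hσt
    rcases eq_or_lt_of_le (le_max_left 0 (c - η / 4)) with h1 | h1
    · have h1' : s₁ = 0 := h1.symm
      rw [h1', hγ₀.map_zero]
      refine h0.congr' (hσ.mono fun i hi => ?_)
      have h3 : σ i = 0 := le_antisymm (h1' ▸ hi.2.2) hi.1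
      simp only [h3]
    · refine hlt s₁ (le_max_left _ _) ?_ σ (hσ.mono fun i hi => ⟨hi.1, hi.2.1⟩) hσt
      rcases max_choice 0 (c - η / 4) with h2 | h2
      · exact absurd h2 h1.ne'
      · rw [hs₁, h2]; linarith
  obtain ⟨s, hsB, hsη⟩ := exists_lt_of_csInf_lt hBne (show sInf B < c + η / 4 by linarith)
  have hcs : c ≤ s := csInf_le hBbd hsB
  refine hsB.2 fun σ hσ hσs => ?_
  have hmin : Tendsto (fun i => min (σ i) s₁) l (𝓝 s₁) := by
    have := hσs.min (tendsto_const_nhds (x := s₁))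
    rwa [min_eq_right (hs₁c.trans hcs)] at this
  have hσ1 : ∀ᶠ i in l, c - η / 2 ≤ min (σ i) s₁ :=
    hmin.eventually (Ici_mem_nhds (by linarith))
  have hσ2 : ∀ᶠ i in l, σ i ≤ c + η / 2 := hσs.eventually (Iic_mem_nhds (by linarith))
  refine hstep γ₀ (c - η / 2) (c + η / 2) (hγ₀.curve.mono fun r hr => (hball r hr).2)
    (fun r hr => (hball r hr).1) γ (fun i => min (σ i) s₁) σ s₁ s ?_ ⟨by linarith, by linarith⟩
    ⟨by linarith, by linarith⟩ hmin hσs (hstart _ ?_ hmin)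
  · filter_upwards [hγ, hσ, hσ1, hσ2] with i hi hi' h1 h2
    have hsub : Icc (min (σ i) s₁) (σ i) ⊆ Icc 0 (τ i) :=
      Icc_subset_Icc (le_min hi'.1 (le_max_left _ _)) hi'.2
    exact ⟨h1, min_le_left _ _, h2, hi.2.1.mono hsub, fun r hr => hi.2.2 r (hsub hr)⟩
  · filter_upwards [hσ] with i hi
    exact ⟨le_min hi.1 (le_max_left _ _), (min_le_left _ _).trans hi.2, min_le_right _ _⟩

/-- The domains of forward maximal integral curves are lower semicontinuous in the initial point and
in the vector field. -/
theorem eventually_mem_of_locallyConverges {l : Ultrafilter ι}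
    (hv : ContMDiff I I.tangent 1 (fun x => (⟨x, v x⟩ : TangentBundle I X)))
    (hwi : ∀ᶠ i in (l : Filter ι),
      ContMDiff I I.tangent 1 (fun x => (⟨x, w i x⟩ : TangentBundle I X)))
    (hw : LocallyConverges I w v l A P) {u : X} {γ₀ : ℝ → X} {J₀ : Set ℝ}
    (hγ₀ : IsCurveFrom v u γ₀ J₀) (hP : ∀ t ∈ J₀, γ₀ t ∈ P) {x : ι → X} {γ : ι → ℝ → X}
    {J : ι → Set ℝ}
    (hγ : ∀ᶠ i in (l : Filter ι), IsForwardMaximal (w i) (x i) (γ i) (J i) ∧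
      ∀ r ∈ J i, 0 ≤ r → γ i r ∈ A)
    (h0 : Tendsto x l (𝓝 u)) {s : ℝ} (hs : s ∈ J₀) (hs0 : 0 ≤ s) :
    ∀ᶠ i in (l : Filter ι), s ∈ J i := by
  have : LocallyCompactSpace X := Manifold.locallyCompact_of_finiteDimensional I
  by_contra hcon
  rw [← Ultrafilter.eventually_not] at hcon
  have hsub := hγ₀.Icc_subset hs
  -- the curves leave a compact neighbourhood `N` of the limit arc before time `s`
  obtain ⟨N, hN, hN'⟩ := exists_compact_superset
    (isCompact_Icc.image_of_continuousOn (hγ₀.curve.continuousOn.mono hsub))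
  have hex : ∀ᶠ i in (l : Filter ι), ∃ τ ∈ J i, 0 ≤ τ ∧ τ ≤ s ∧ γ i τ ∉ N := by
    filter_upwards [hcon, hγ, hwi] with i h1 h2 h3
    exact h2.1.exists_notMem_of_isCompact h3 h1 hs0 hN
  have hex' : ∀ i, ∃ τ, (∃ τ ∈ J i, 0 ≤ τ ∧ τ ≤ s ∧ γ i τ ∉ N) →
      τ ∈ J i ∧ 0 ≤ τ ∧ τ ≤ s ∧ γ i τ ∉ N := by
    intro i
    by_cases h : ∃ τ ∈ J i, 0 ≤ τ ∧ τ ≤ s ∧ γ i τ ∉ N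
    · obtain ⟨τ, hτ⟩ := h; exact ⟨τ, fun _ => hτ⟩
    · exact ⟨0, fun h' => absurd h' h⟩
  choose τ hτ using hex'
  have hτe : ∀ᶠ i in (l : Filter ι), τ i ∈ J i ∧ 0 ≤ τ i ∧ τ i ≤ s ∧ γ i (τ i) ∉ N :=
    hex.mono fun i hi => hτ i hi
  obtain ⟨t, ht, htl⟩ := (isCompact_Icc (a := (0 : ℝ)) (b := s)).ultrafilter_le_nhds
    (l.map τ) (by
      rw [Ultrafilter.coe_map, le_principal_iff, mem_map]
      exact hτe.mono fun i hi => ⟨hi.2.1, hi.2.2.1⟩)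
  have hlim : Tendsto (fun i => γ i (τ i)) l (𝓝 (γ₀ t)) := by
    refine tendsto_of_locallyConverges hv hw hγ₀ hP ?_ ?_ (hsub ht) htl
    · filter_upwards [hτe, hγ] with i h1 h2
      have h3 := h2.1.Icc_subset h1.1
      exact ⟨h1.2.1, h2.1.curve.mono h3, fun r hr => h2.2 r (h3 hr) hr.1⟩
    · exact h0.congr' (hγ.mono fun i hi => hi.1.map_zero.symm)
  have := hlim.eventually (isOpen_interior.mem_nhds (hN' (mem_image_of_mem _ ht)))
  obtain ⟨i, hi1, hi2⟩ := (this.and hτe).exists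
  exact hi2.2.2.2 (interior_subset hi1)

end ODE

end

/-! ### The Lie bracket in charts, and multiplication in the fibres of the tangent bundle -/

section

section Bracket

variable {F : Type*} [NormedAddCommGroup F] [NormedSpace ℝ F]
  {H : Type*} [TopologicalSpace H] {I : ModelWithCorners ℝ F H}
  {X : Type*} [TopologicalSpace X] [ChartedSpace H X] [IsManifold I 1 X]

theorem mpullbackWithin_extChartAt_symm (p : X) (w : (x : X) → TangentSpace I x) {z : F}
    (hz : z ∈ (extChartAt I p).target) :
    VectorField.mpullbackWithin 𝓘(ℝ, F) I (extChartAt I p).symm w (range I) z =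
      fieldInChart I p w ((extChartAt I p).symm z) := by
  have hsrc : (extChartAt I p).symm z ∈ (chartAt H p).source := by
    rw [← extChartAt_source I p]
    exact (extChartAt I p).map_target hz
  refine (DFunLike.congr_fun (ContinuousLinearMap.inverse_eq
    (mfderivWithin_extChartAt_symm_comp_mfderiv_extChartAt hz)
    (mfderiv_extChartAt_comp_mfderivWithin_extChartAt_symm hz)) _).trans ?_
  exact (DFunLike.congr_fun ((hasMFDerivAt_extChartAt (I := I) hsrc).mfderiv.trans
    (mfderiv_chartAt_eq_tangentCoordChange hsrc)) (w ((extChartAt I p).symm z)))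

/-- The Lie bracket of vector fields, computed in the chart at the point under consideration. -/
theorem mlieBracket_eq_lieBracket_fieldInChart [I.Boundaryless]
    (V W : (x : X) → TangentSpace I x) (p : X) :
    VectorField.mlieBracket I V W p = VectorField.lieBracket ℝ
      (fun z => fieldInChart I p V ((extChartAt I p).symm z))
      (fun z => fieldInChart I p W ((extChartAt I p).symm z)) (extChartAt I p p) := by
  have hsrc := mem_extChartAt_source (I := I) p
  have hsrc' : p ∈ (chartAt H p).source := mem_chart_source H p
  have hid : mfderiv I 𝓘(ℝ, F) (extChartAt I p) p = ContinuousLinearMap.id ℝ F := by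
    refine ((hasMFDerivAt_extChartAt (I := I) hsrc').mfderiv.trans
      (mfderiv_chartAt_eq_tangentCoordChange hsrc')).trans ?_
    exact ContinuousLinearMap.ext fun y => tangentCoordChange_self hsrc
  have hinv : (mfderiv I 𝓘(ℝ, F) (extChartAt I p) p).inverse = ContinuousLinearMap.id ℝ F :=
    (congrArg (ContinuousLinearMap.inverse (M := F) (M₂ := F)) hid).trans
      ContinuousLinearMap.inverse_id
  have hV : ∀ w : (x : X) → TangentSpace I x,
      VectorField.mpullbackWithin 𝓘(ℝ, F) I (extChartAt I p).symm w (range I)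
        =ᶠ[𝓝 (extChartAt I p p)] fun z => fieldInChart I p w ((extChartAt I p).symm z) := by
    intro w
    filter_upwards [extChartAt_target_mem_nhds (I := I) p] with z hz
    exact mpullbackWithin_extChartAt_symm p w hz
  have h1 : ∀ z : F, (mfderiv I 𝓘(ℝ, F) (extChartAt I p) p).inverse z = z :=
    DFunLike.congr_fun hinv
  let A : ((x : X) → TangentSpace I x) → F → F := fun w =>
    VectorField.mpullbackWithin 𝓘(ℝ, F) I (extChartAt I p).symm w (range I)
  have h2 : VectorField.lieBracketWithin ℝ (A V) (A W)
      ((extChartAt I p).symm ⁻¹' univ ∩ range I) (extChartAt I p p) = VectorField.lieBracket ℝ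
        (fun z => fieldInChart I p V ((extChartAt I p).symm z))
        (fun z => fieldInChart I p W ((extChartAt I p).symm z)) (extChartAt I p p) := by
    rw [preimage_univ, univ_inter, I.range_eq_univ, VectorField.lieBracketWithin_univ]
    exact (hV V).lieBracket_vectorField_eq (hV W)
  rw [← VectorField.mlieBracketWithin_univ, VectorField.mlieBracketWithin_apply]
  exact (h1 _).trans h2

end Bracket

variable {E : Type*} [NormedAddCommGroup E] [NormedSpace ℝ E]
  {M : Type*} [TopologicalSpace M] [ChartedSpace E M]

/-- Fibrewise multiplication by `c` on the tangent bundle. -/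
def scale (c : ℝ) (v : TM E M) : TM E M := ⟨v.proj, c • v.snd⟩

/-- Fibrewise multiplication by `c` in bundle coordinates: `(x, y) ↦ (x, c y)`. -/
def scaleCLM (E : Type*) [NormedAddCommGroup E] [NormedSpace ℝ E] (c : ℝ) : E × E →L[ℝ] E × E :=
  (ContinuousLinearMap.fst ℝ E E).prod (c • ContinuousLinearMap.snd ℝ E E)

@[simp] theorem scaleCLM_apply (c : ℝ) (z : E × E) : scaleCLM E c z = (z.1, c • z.2) := rfl

@[simp] theorem scale_proj (c : ℝ) (v : TM E M) : (scale c v).proj = v.proj := rfl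

@[simp] theorem scale_snd (c : ℝ) (v : TM E M) : (scale c v).snd = c • v.snd := rfl

@[simp] theorem scale_one (v : TM E M) : scale 1 v = v := by
  simp [scale]

theorem scale_scale (c d : ℝ) (v : TM E M) : scale c (scale d v) = scale (c * d) v :=
  congrArg (TotalSpace.mk v.proj) (smul_smul c d v.snd)

variable [IsManifold 𝓘(ℝ, E) ∞ M]

theorem extChartAt_TM_apply (p q : TM E M) : extChartAt 𝓘(ℝ, E).tangent p q =
    (extChartAt 𝓘(ℝ, E) p.proj q.proj,
      tangentCoordChange 𝓘(ℝ, E) q.proj p.proj q.proj q.snd) := rfl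

theorem mem_extChartAt_TM_source {p q : TM E M} :
    q ∈ (extChartAt 𝓘(ℝ, E).tangent p).source ↔
      q.proj ∈ (extChartAt 𝓘(ℝ, E) p.proj).source := by
  simp

theorem extChartAt_TM_scale (p : TM E M) (c : ℝ) (q : TM E M) :
    extChartAt 𝓘(ℝ, E).tangent p (scale c q) = scaleCLM E c (extChartAt 𝓘(ℝ, E).tangent p q) := by
  rw [extChartAt_TM_apply, extChartAt_TM_apply, scaleCLM_apply]
  exact Prod.ext rfl (map_smul (tangentCoordChange 𝓘(ℝ, E) q.proj p.proj q.proj) c q.snd)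

theorem continuous_scale : Continuous fun z : ℝ × TM E M => scale z.1 z.2 := by
  rw [continuous_iff_continuousAt]
  rintro ⟨c, q⟩
  rw [FiberBundle.continuousAt_totalSpace]
  refine ⟨((FiberBundle.continuous_proj E (TangentSpace 𝓘(ℝ, E))).comp
    continuous_snd).continuousAt, ?_⟩
  have h1 : ContinuousAt (fun z : ℝ × TM E M => z.1 • (extChartAt 𝓘(ℝ, E).tangent q z.2).2)
      (c, q) :=
    continuousAt_fst.smul (continuousAt_snd.comp
      (ContinuousAt.comp (f := Prod.snd) (x := (c, q))
        (continuousAt_extChartAt (I := 𝓘(ℝ, E).tangent) q) continuousAt_snd))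
  refine h1.congr (Eventually.of_forall fun z => ?_)
  exact (map_smul (tangentCoordChange 𝓘(ℝ, E) z.2.proj q.proj z.2.proj) z.1 z.2.snd).symm

theorem hasMFDerivAt_scale (c : ℝ) (q : TM E M) :
    HasMFDerivAt 𝓘(ℝ, E).tangent 𝓘(ℝ, E).tangent (scale c) q (scaleCLM E c) := by
  refine ⟨(continuous_scale.comp (Continuous.prodMk_right c)).continuousAt, ?_⟩
  refine ((scaleCLM E c).hasFDerivAt.hasFDerivWithinAt).congr_of_eventuallyEq ?_ ?_
  · refine mem_nhdsWithin_of_mem_nhds ?_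
    filter_upwards [extChartAt_target_mem_nhds (I := 𝓘(ℝ, E).tangent) q] with z hz
    have := extChartAt_TM_scale q c ((extChartAt 𝓘(ℝ, E).tangent q).symm z)
    rw [(extChartAt 𝓘(ℝ, E).tangent q).right_inv hz] at this
    exact this
  · have := extChartAt_TM_scale q c q
    rw [writtenInExtChartAt, Function.comp_apply, Function.comp_apply,
      (extChartAt 𝓘(ℝ, E).tangent q).left_inv (mem_extChartAt_source q)]
    exact this

/-- The vector field `w` on `TM` is homogeneous in the sense that `w (c • v)` is `c` times the image
of `w v` under the differential of `v ↦ c • v`, for `c > 0`. Both sides are read in the chart given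
by the base point. -/
def IsScaling (w : (v : TM E M) → TangentSpace 𝓘(ℝ, E).tangent v) : Prop :=
  ∀ c : ℝ, 0 < c → ∀ q : TM E M, (w (scale c q) : E × E) = c • scaleCLM E c (w q)

theorem IsScaling.neg {w : (v : TM E M) → TangentSpace 𝓘(ℝ, E).tangent v} (hw : IsScaling w) :
    IsScaling (-w) := by
  intro c hc q
  have h : ∀ z : E × E, -(c • scaleCLM E c z) = c • scaleCLM E c (-z) := fun z => by
    rw [map_neg, smul_neg]
  exact (congrArg (fun z : E × E => -z) (hw c hc q)).trans (h (w q))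

theorem hasFDerivAt_coordChange_TM {p q r : TM E M} (hq : r.proj = q.proj)
    (hp : r.proj ∈ (extChartAt 𝓘(ℝ, E) p.proj).source) :
    HasFDerivAt (extChartAt 𝓘(ℝ, E).tangent p ∘ (extChartAt 𝓘(ℝ, E).tangent q).symm)
      (tangentCoordChange 𝓘(ℝ, E).tangent q p r) (extChartAt 𝓘(ℝ, E).tangent q r) := by
  have := hasFDerivWithinAt_tangentCoordChange (I := 𝓘(ℝ, E).tangent) (x := q) (y := p) (z := r)
    ⟨mem_extChartAt_TM_source.2 (by rw [hq]; exact mem_extChartAt_source _),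
      mem_extChartAt_TM_source.2 hp⟩
  rwa [ModelWithCorners.range_eq_univ, hasFDerivWithinAt_univ] at this

/-- Homogeneity can be read in any chart of `TM`. -/
theorem IsScaling.fieldInChart_scale {w : (v : TM E M) → TangentSpace 𝓘(ℝ, E).tangent v}
    (hw : IsScaling w) {c : ℝ} (hc : 0 < c) (p : TM E M) {q : TM E M}
    (hq : q.proj ∈ (extChartAt 𝓘(ℝ, E) p.proj).source) :
    fieldInChart 𝓘(ℝ, E).tangent p w (scale c q) =
      c • scaleCLM E c (fieldInChart 𝓘(ℝ, E).tangent p w q) := by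
  set φ := extChartAt 𝓘(ℝ, E).tangent q with hφ
  have h1 := hasFDerivAt_coordChange_TM (p := p) (q := q) (r := q) rfl hq
  have h2 := hasFDerivAt_coordChange_TM (p := p) (q := q) (r := scale c q) rfl hq
  rw [extChartAt_TM_scale] at h2
  have h3 := h2.comp (φ q) (scaleCLM E c).hasFDerivAt
  have h4 := (scaleCLM E c).hasFDerivAt.comp (φ q) h1
  have h5 : (extChartAt 𝓘(ℝ, E).tangent p ∘ φ.symm) ∘ scaleCLM E c =ᶠ[𝓝 (φ q)]
      scaleCLM E c ∘ (extChartAt 𝓘(ℝ, E).tangent p ∘ φ.symm) := by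
    filter_upwards [extChartAt_target_mem_nhds (I := 𝓘(ℝ, E).tangent) q] with z hz
    have h6 := extChartAt_TM_scale q c (φ.symm z)
    rw [← hφ, φ.right_inv hz] at h6
    have h7 : φ.symm (scaleCLM E c z) = scale c (φ.symm z) := by
      rw [← h6]
      refine φ.left_inv ?_
      exact mem_extChartAt_TM_source.2 (mem_extChartAt_TM_source.1 (φ.map_target hz))
    simp only [Function.comp_apply, h7, extChartAt_TM_scale]
  have h8 := (h3.congr_of_eventuallyEq h5.symm).unique h4
  have h9 := DFunLike.congr_fun h8 (w q : E × E)
  have h10 : fieldInChart 𝓘(ℝ, E).tangent p w (scale c q) =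
      tangentCoordChange 𝓘(ℝ, E).tangent q p (scale c q) (c • scaleCLM E c (w q)) := by
    rw [← hw c hc q]; rfl
  rw [h10, map_smul]
  exact congrArg (c • ·) h9

end

/-! ### Homogeneous sprays -/

section

variable {E : Type*} [NormedAddCommGroup E] [NormedSpace ℝ E]
  {M : Type*} [TopologicalSpace M] [ChartedSpace E M]

/-- The fibre component of a tangent vector, as an element of the model space. -/
def vel (q : TM E M) : E := q.snd

theorem vel_scale (c : ℝ) (q : TM E M) : vel (scale c q) = c • vel q := rfl

variable [IsManifold 𝓘(ℝ, E) ∞ M]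

theorem hasDerivAt_scaleCLM (z : E × E) (t : ℝ) :
    HasDerivAt (fun t : ℝ => scaleCLM E t z) (0, z.2) t := by
  have h1 := (hasDerivAt_const t z.1).prodMk ((hasDerivAt_id t).smul_const z.2)
  rw [one_smul] at h1
  exact h1

theorem hasMFDerivAt_scale_left (q : TM E M) :
    HasMFDerivAt 𝓘(ℝ, ℝ) 𝓘(ℝ, E).tangent (fun t : ℝ => scale t q) 1
      ((1 : ℝ →L[ℝ] ℝ).smulRight ((0, (extChartAt 𝓘(ℝ, E).tangent q q).2) : E × E)) := by
  have h2 := (hasDerivAt_scaleCLM (extChartAt 𝓘(ℝ, E).tangent q q)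
    1).hasFDerivAt.hasFDerivWithinAt (s := range 𝓘(ℝ, ℝ))
  refine ⟨(continuous_scale.comp (Continuous.prodMk_left q)).continuousAt, ?_⟩
  have h3 : ∀ t : ℝ, writtenInExtChartAt 𝓘(ℝ, ℝ) 𝓘(ℝ, E).tangent 1 (fun t : ℝ => scale t q) t
      = scaleCLM E t (extChartAt 𝓘(ℝ, E).tangent q q) := fun t =>
    (congrArg (fun r : TM E M => extChartAt 𝓘(ℝ, E).tangent r (scale t q)) (scale_one q)).trans
      (extChartAt_TM_scale q t q)
  exact h2.congr_of_eventuallyEq (Eventually.of_forall h3) (h3 1)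

theorem euler_eq (q : TM E M) :
    (euler q : E × E) = (0, (extChartAt 𝓘(ℝ, E).tangent q q).2) := by
  have h : HasMFDerivAt 𝓘(ℝ, ℝ) 𝓘(ℝ, E).tangent
      (fun t : ℝ => (⟨q.proj, t • q.snd⟩ : TM E M)) 1
      ((1 : ℝ →L[ℝ] ℝ).smulRight ((0, (extChartAt 𝓘(ℝ, E).tangent q q).2) : E × E)) :=
    hasMFDerivAt_scale_left q
  exact (DFunLike.congr_fun h.mfderiv (1 : ℝ)).trans
    (one_smul ℝ ((0, (extChartAt 𝓘(ℝ, E).tangent q q).2) : E × E))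

theorem fieldInChart_euler (p : TM E M) {q : TM E M}
    (hq : q.proj ∈ (extChartAt 𝓘(ℝ, E) p.proj).source) :
    fieldInChart 𝓘(ℝ, E).tangent p euler q = (0, (extChartAt 𝓘(ℝ, E).tangent p q).2) := by
  set φ := extChartAt 𝓘(ℝ, E).tangent q with hφ
  have h1 := hasFDerivAt_coordChange_TM (p := p) (q := q) (r := q) rfl hq
  have h1' : HasFDerivAt (extChartAt 𝓘(ℝ, E).tangent p ∘ φ.symm)
      (tangentCoordChange 𝓘(ℝ, E).tangent q p q) (scaleCLM E 1 (φ q)) := by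
    rw [show scaleCLM E 1 (φ q) = φ q from Prod.ext rfl (one_smul ℝ (φ q).2)]
    exact h1
  have h2 := h1'.comp_hasDerivAt (1 : ℝ) (hasDerivAt_scaleCLM (φ q) 1)
  have h3 := hasDerivAt_scaleCLM (extChartAt 𝓘(ℝ, E).tangent p q) 1
  have h4 : ((extChartAt 𝓘(ℝ, E).tangent p ∘ φ.symm) ∘ fun t : ℝ => scaleCLM E t (φ q)) =
      fun t : ℝ => scaleCLM E t (extChartAt 𝓘(ℝ, E).tangent p q) := by
    funext t
    rw [Function.comp_apply, hφ, ← extChartAt_TM_scale, Function.comp_apply, ← extChartAt_TM_scale]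
    congr 1
    exact φ.left_inv (mem_extChartAt_TM_source.2 (mem_extChartAt_source q.proj))
  rw [h4] at h2
  have h5 := h2.unique h3
  exact (congrArg (fun z : E × E => tangentCoordChange 𝓘(ℝ, E).tangent q p q z)
    (euler_eq q)).trans h5

theorem hasMFDerivAt_proj (q : TM E M) :
    HasMFDerivAt 𝓘(ℝ, E).tangent 𝓘(ℝ, E) (fun w : TM E M => w.proj) q
      (ContinuousLinearMap.fst ℝ E E) := by
  refine ⟨(FiberBundle.continuous_proj E (TangentSpace 𝓘(ℝ, E))).continuousAt, ?_⟩
  refine ((ContinuousLinearMap.fst ℝ E E).hasFDerivAt.hasFDerivWithinAt).congr_of_eventuallyEq ?_ ?_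
  · refine mem_nhdsWithin_of_mem_nhds ?_
    filter_upwards [extChartAt_target_mem_nhds (I := 𝓘(ℝ, E).tangent) q] with z hz
    exact congrArg Prod.fst ((extChartAt 𝓘(ℝ, E).tangent q).right_inv hz)
  · exact congrArg Prod.fst ((extChartAt 𝓘(ℝ, E).tangent q).right_inv
      ((extChartAt 𝓘(ℝ, E).tangent q).map_source (mem_extChartAt_source q)))

/-- The value of a spray, with the tangent space of `TM` identified with `E × E` by the chart at the
point. -/
def Spray.coord (S : Spray E M) (q : TM E M) : E × E := S.field q

theorem Spray.coord_fst (S : Spray E M) (q : TM E M) : (S.coord q).1 = vel q :=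
  (DFunLike.congr_fun (hasMFDerivAt_proj q).mfderiv (S.coord q)).symm.trans (S.second_order q)

/-- In a chart, homogeneity of degree `m` of a spray is the Euler equation along each ray: the
function `t ↦ S (t v)` of `t` satisfies `t f' = (m - 1) f + (0, f₂)`. -/
theorem Spray.hasDerivAt_coord_scale (S : Spray E M) {m : ℝ} (hS : S.IsHomogeneous m)
    (v : TM E M) (t : ℝ) :
    ∃ d : E × E, HasDerivAt (fun s : ℝ => S.coord (scale s v)) d t ∧
      t • d = (m - 1) • S.coord (scale t v) + (0, (S.coord (scale t v)).2) := by
  set q := scale t v with hq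
  set φ := extChartAt 𝓘(ℝ, E).tangent q with hφ
  set f : E × E → E × E := fun z => fieldInChart 𝓘(ℝ, E).tangent q S.field (φ.symm z) with hf
  set e : E × E → E × E := fun z => fieldInChart 𝓘(ℝ, E).tangent q euler (φ.symm z) with he
  have hfd : DifferentiableAt ℝ f (φ q) :=
    (contDiffAt_fieldInChart ((S.smooth.of_le (by norm_num)).contMDiffAt (x := q))).differentiableAt
      (by norm_num)
  have hφq : φ.symm (φ q) = q := φ.left_inv (mem_extChartAt_source q)
  have hfq : f (φ q) = S.coord q :=
    (congrArg (fieldInChart 𝓘(ℝ, E).tangent q S.field) hφq).trans (fieldInChart_self q S.field)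
  have hee : e =ᶠ[𝓝 (φ q)] ((0 : E × E →L[ℝ] E).prod (ContinuousLinearMap.snd ℝ E E)) := by
    filter_upwards [extChartAt_target_mem_nhds (I := 𝓘(ℝ, E).tangent) q] with z hz
    rw [he]
    beta_reduce
    rw [fieldInChart_euler q (mem_extChartAt_TM_source.1 (φ.map_target hz)), ← hφ, φ.right_inv hz]
    rfl
  have hed : fderiv ℝ e (φ q) = (0 : E × E →L[ℝ] E).prod (ContinuousLinearMap.snd ℝ E E) := by
    rw [hee.fderiv_eq]
    exact ContinuousLinearMap.fderiv _
  have hbr : fderiv ℝ f (φ q) (0, (φ q).2) - (0, (f (φ q)).2) = (m - 1) • f (φ q) := by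
    have h1 := (mlieBracket_eq_lieBracket_fieldInChart (I := 𝓘(ℝ, E).tangent) euler S.field
      q).symm.trans (hS q)
    have h2 : fderiv ℝ f (φ q) (e (φ q)) - fderiv ℝ e (φ q) (f (φ q)) = (m - 1) • f (φ q) :=
      h1.trans (congrArg (fun z : E × E => (m - 1) • z) hfq.symm)
    rw [hed, hee.eq_of_nhds] at h2
    exact h2
  -- the ray through `v`, in the chart
  have hray : ∀ s : ℝ, φ (scale s v) = scaleCLM E s (φ v) := fun s => extChartAt_TM_scale q s v
  have hrayd := hasDerivAt_scaleCLM (φ v) t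
  have hcomp : ∀ s : ℝ, f (scaleCLM E s (φ v)) = S.coord (scale s v) := by
    intro s
    have h1 : φ.symm (scaleCLM E s (φ v)) = scale s v := by
      rw [← hray s]
      exact φ.left_inv (mem_extChartAt_TM_source.2 (mem_extChartAt_source v.proj))
    exact (congrArg (fieldInChart 𝓘(ℝ, E).tangent q S.field) h1).trans
      (fieldInChart_self (scale s v) S.field)
  refine ⟨fderiv ℝ f (φ q) (0, (φ v).2), ?_, ?_⟩
  · have h1 : HasFDerivAt f (fderiv ℝ f (φ q)) (scaleCLM E t (φ v)) := by
      rw [← hray t]; exact hfd.hasFDerivAt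
    have h2 := h1.comp_hasDerivAt t hrayd
    refine h2.congr_of_eventuallyEq (Eventually.of_forall fun s => (hcomp s).symm)
  · have h1 : t • fderiv ℝ f (φ q) (0, (φ v).2) = fderiv ℝ f (φ q) (0, (φ q).2) := by
      rw [← map_smul]
      congr 1
      rw [show φ q = scaleCLM E t (φ v) from hray t]
      simp
    rw [h1, ← hfq, ← hbr]
    abel

/-- A homogeneous spray has degree `2`, unless `M` has dimension `0`, and its acceleration is then
positively homogeneous of degree `2` in the velocity. -/
theorem Spray.IsHomogeneous.isScaling {S : Spray E M} {m : ℝ} (hS : S.IsHomogeneous m) :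
    IsScaling S.field := by
  intro c hc q
  change S.coord (scale c q) = c • scaleCLM E c (S.coord q)
  by_cases hm : m = 2
  · subst hm
    set f : ℝ → E := fun s => (S.coord (scale s q)).2 with hf
    choose d hd hd2 using S.hasDerivAt_coord_scale hS q
    have hfd : ∀ s, HasDerivAt f (d s).2 s := fun s => (hd s).snd
    have hfd2 : ∀ s, s • (d s).2 = (2 : ℝ) • f s := by
      intro s
      have := congrArg Prod.snd (hd2 s)
      simp only [Prod.smul_snd, Prod.snd_add] at this
      rw [this, two_smul]
      norm_num [hf]
    -- `f s / s ^ 2` is constant on the positive half line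
    have hgd : ∀ s ∈ Ioi (0 : ℝ), HasDerivAt (fun s : ℝ => (s ^ 2)⁻¹ • f s) 0 s := by
      intro s hs
      have hs0 : s ≠ 0 := ne_of_gt hs
      have h1 := ((hasDerivAt_pow 2 s).fun_inv (pow_ne_zero 2 hs0)).fun_smul (hfd s)
      convert! h1 using 1
      have h2 : (d s).2 = (2 * s⁻¹) • f s := by
        rw [mul_comm, mul_smul, ← hfd2 s, smul_smul, inv_mul_cancel₀ hs0, one_smul]
      rw [h2, smul_smul, ← add_smul, eq_comm]
      convert zero_smul ℝ (f s)
      field_simp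
      rw [Nat.cast_ofNat]
      ring
    have hconst := isOpen_Ioi.is_const_of_deriv_eq_zero (s := Ioi (0 : ℝ)) isPreconnected_Ioi
      (f := fun s : ℝ => (s ^ 2)⁻¹ • f s)
      (fun s hs => (hgd s hs).differentiableAt.differentiableWithinAt)
      (fun s hs => (hgd s hs).deriv) (show c ∈ Ioi (0 : ℝ) from hc)
      (mem_Ioi.2 one_pos : (1 : ℝ) ∈ Ioi 0)
    have h2 : f c = c • c • f 1 := by
      have h3 : f c = (c ^ 2) • ((c ^ 2)⁻¹ • f c) := by
        rw [smul_smul, mul_inv_cancel₀ (pow_ne_zero 2 hc.ne'), one_smul]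
      rw [h3]
      rw [hconst, smul_smul, smul_smul]
      simp [pow_two]
    have h3 : f 1 = (S.coord q).2 := by rw [hf]; simp only [scale_one]
    rw [h3] at h2
    refine Prod.ext ?_ h2
    rw [S.coord_fst, vel_scale, ← S.coord_fst]
    rfl
  · -- the first component of the Euler equation reads `y = (m - 1) y`
    have hzero : ∀ y : E, y = 0 := by
      intro y
      let v : TM E M := ⟨q.proj, y⟩
      obtain ⟨d, hd, hd2⟩ := S.hasDerivAt_coord_scale hS v 1
      have h1 : HasDerivAt (fun s : ℝ => s • y) d.1 1 :=
        (show HasDerivAt (fun s : ℝ => (S.coord (scale s v)).1) d.1 1 from hd.fst).congr_of_eventuallyEq (Eventually.of_forall fun s : ℝ => (S.coord_fst (scale s v)).symm)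
      have h2 : d.1 = y := by
        have := h1.unique ((hasDerivAt_id (1 : ℝ)).smul_const y)
        rwa [one_smul] at this
      have h3 := congrArg Prod.fst hd2
      simp only [one_smul, Prod.fst_add, Prod.smul_fst, add_zero, scale_one] at h3
      rw [S.coord_fst, h2] at h3
      have h4 : (m - 2) • y = 0 := by
        have : y = (m - 1) • y := h3
        rw [show m - 2 = (m - 1) - 1 by ring, sub_smul, one_smul, ← this, sub_self]
      exact (smul_eq_zero.1 h4).resolve_left (sub_ne_zero.2 hm)
    have : Subsingleton E := ⟨fun a b => (hzero a).trans (hzero b).symm⟩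
    exact Subsingleton.elim _ _

end

/-! ### Topology of the tangent bundle -/

section

section Topology

/-- A connected, paracompact, locally compact Hausdorff space is σ-compact. -/
theorem sigmaCompactSpace_of_connected_paracompact (X : Type*) [TopologicalSpace X] [T2Space X]
    [ParacompactSpace X] [ConnectedSpace X] [WeaklyLocallyCompactSpace X] :
    SigmaCompactSpace X := by
  choose C hC hCx using fun x : X => exists_compact_mem_nhds x
  obtain ⟨v, hvo, hvU, hvf, hvC⟩ := precise_refinement (fun x => interior (C x))
    (fun _ => isOpen_interior)
    (iUnion_eq_univ_iff.2 fun x => ⟨x, mem_interior_iff_mem_nhds.2 (hCx x)⟩)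
  have hcl : ∀ i, IsCompact (closure (v i)) := fun i =>
    (hC i).closure_of_subset ((hvC i).trans interior_subset)
  obtain ⟨x₀⟩ : Nonempty X := inferInstance
  -- start at a point and repeatedly add all the members of the cover that are met
  let A : ℕ → Set X := fun n => Nat.rec {x₀}
    (fun _ B => ⋃ i ∈ {i | (v i ∩ B).Nonempty}, closure (v i)) n
  have hA : ∀ n, A (n + 1) = ⋃ i ∈ {i | (v i ∩ A n).Nonempty}, closure (v i) := fun _ => rfl
  have hAc : ∀ n, IsCompact (A n) := by
    intro n
    induction n with
    | zero => exact isCompact_singleton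
    | succ n ih =>
      rw [hA]
      exact (hvf.finite_nonempty_inter_compact ih).isCompact_biUnion fun i _ => hcl i
  have hmem : ∀ n i, (v i ∩ A n).Nonempty → v i ⊆ A (n + 1) := fun n i h => by
    rw [hA]
    exact subset_closure.trans (subset_biUnion_of_mem (u := fun i => closure (v i)) h)
  have hopen : IsOpen (⋃ n, A n) := by
    rw [isOpen_iff_mem_nhds]
    intro x hx
    obtain ⟨n, hn⟩ := mem_iUnion.1 hx
    obtain ⟨i, hi⟩ := iUnion_eq_univ_iff.1 hvU x
    filter_upwards [(hvo i).mem_nhds hi] with y hy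
    exact mem_iUnion.2 ⟨n + 1, hmem n i ⟨x, hi, hn⟩ hy⟩
  have hclosed : IsClosed (⋃ n, A n) := by
    rw [← isOpen_compl_iff, isOpen_iff_mem_nhds]
    intro x hx
    obtain ⟨i, hi⟩ := iUnion_eq_univ_iff.1 hvU x
    filter_upwards [(hvo i).mem_nhds hi] with y hy hyA
    obtain ⟨n, hn⟩ := mem_iUnion.1 hyA
    exact hx (mem_iUnion.2 ⟨n + 1, hmem n i ⟨y, hy, hn⟩ hi⟩)
  have huniv : (⋃ n, A n) = univ :=
    IsClopen.eq_univ ⟨hclosed, hopen⟩ ⟨x₀, mem_iUnion.2 ⟨0, mem_singleton x₀⟩⟩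
  exact ⟨A, hAc, huniv⟩

end Topology

variable {E : Type*} [NormedAddCommGroup E] [NormedSpace ℝ E]
  {M : Type*} [TopologicalSpace M] [ChartedSpace E M] [IsManifold 𝓘(ℝ, E) ∞ M]

theorem continuous_proj_TM : Continuous fun q : TM E M => q.proj :=
  FiberBundle.continuous_proj E (TangentSpace 𝓘(ℝ, E))

theorem t2Space_TM [T2Space M] : T2Space (TM E M) := by
  refine ⟨fun p q hpq => ?_⟩
  by_cases hproj : p.proj = q.proj
  · set φ := extChartAt 𝓘(ℝ, E).tangent p with hφ
    have hp : p ∈ φ.source := mem_extChartAt_source p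
    have hq : q ∈ φ.source :=
      mem_extChartAt_TM_source.2 (by rw [← hproj]; exact mem_extChartAt_source p.proj)
    have hne : φ p ≠ φ q := fun h => hpq (φ.injOn hp hq h)
    obtain ⟨U, V, hU, hV, hpU, hqV, hUV⟩ := t2_separation hne
    refine ⟨φ.source ∩ φ ⁻¹' U, φ.source ∩ φ ⁻¹' V, isOpen_extChartAt_preimage' p hU,
      isOpen_extChartAt_preimage' p hV, ⟨hp, hpU⟩, ⟨hq, hqV⟩, ?_⟩
    exact (hUV.preimage φ).mono inter_subset_right inter_subset_right
  · obtain ⟨U, V, hU, hV, hpU, hqV, hUV⟩ := t2_separation hproj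
    exact ⟨_, _, hU.preimage continuous_proj_TM, hV.preimage continuous_proj_TM, hpU, hqV,
      hUV.preimage _⟩

variable (h : ContMDiffRiemannianMetric 𝓘(ℝ, E) ∞ E (fun x : M => TangentSpace 𝓘(ℝ, E) x))

/-- The length of a tangent vector with respect to the Riemannian metric `h`. -/
def len (q : TM E M) : ℝ := √(h.inner q.proj q.snd q.snd)

theorem continuous_len : Continuous (len h) := by
  let _ : RiemannianBundle (fun x : M => TangentSpace 𝓘(ℝ, E) x) := ⟨h.toRiemannianMetric⟩
  have : IsContinuousRiemannianBundle E (fun x : M => TangentSpace 𝓘(ℝ, E) x) :=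
    ⟨h.inner, h.contMDiff.continuous, fun _ _ _ => rfl⟩
  have := Continuous.inner_bundle (F := E) (B := M) (E := fun x : M => TangentSpace 𝓘(ℝ, E) x)
    (b := fun q : TM E M => q.proj) (v := fun q => q.snd) (w := fun q => q.snd) continuous_id
    continuous_id
  exact this.sqrt

theorem len_scale {c : ℝ} (hc : 0 ≤ c) (q : TM E M) : len h (scale c q) = c * len h q := by
  have : h.inner q.proj (c • q.snd) (c • q.snd) = c ^ 2 * h.inner q.proj q.snd q.snd := by
    simp only [map_smul, smul_apply, smul_eq_mul]
    ring
  refine (congrArg Real.sqrt this).trans ?_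
  rw [Real.sqrt_mul (sq_nonneg c), Real.sqrt_sq hc]
  rfl

theorem len_pos {q : TM E M} (hq : vel q ≠ 0) : 0 < len h q :=
  Real.sqrt_pos.2 (h.pos q.proj q.snd hq)

theorem vel_ne_zero_of_len {q : TM E M} (hq : len h q ≠ 0) : vel q ≠ 0 := by
  intro h0
  have h1 : q.snd = 0 := h0
  refine hq ?_
  rw [len, h1]
  simp

theorem mem_unitBundle_iff {q : TM E M} : q ∈ unitBundle h ↔ len h q = 1 := by
  rw [len, Real.sqrt_eq_one]
  rfl

theorem mem_extChartAt_TM_target {p : TM E M} {z : E × E} :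
    z ∈ (extChartAt 𝓘(ℝ, E).tangent p).target ↔ z.1 ∈ (extChartAt 𝓘(ℝ, E) p.proj).target := by
  simp only [extChartAt_target, modelWithCornersSelf_coe_symm, preimage_id, modelWithCornersSelf_coe,
    range_id, inter_univ, ModelWithCorners.range_eq_univ]
  exact TangentBundle.mem_chart_target_iff z p

/-- The unit sphere bundle over a compact set is compact. -/
theorem isCompact_unitBundle_inter [FiniteDimensional ℝ E] [T2Space M] {L : Set M}
    (hL : IsCompact L) : IsCompact (unitBundle h ∩ (fun q : TM E M => q.proj) ⁻¹' L) := by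
  have : T2Space (TM E M) := t2Space_TM
  have hclosed : IsClosed (unitBundle h) := by
    have : unitBundle h = {q | len h q = 1} := ext fun q => mem_unitBundle_iff h
    rw [this]
    exact isClosed_eq (continuous_len h) continuous_const
  suffices H : ∃ K : Set (TM E M), IsCompact K ∧
      unitBundle h ∩ (fun q : TM E M => q.proj) ⁻¹' L ⊆ K by
    obtain ⟨K, hK, hKL⟩ := H
    exact hK.of_isClosed_subset (hclosed.inter (hL.isClosed.preimage continuous_proj_TM)) hKL
  refine hL.induction_on (p := fun L => ∃ K : Set (TM E M), IsCompact K ∧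
    unitBundle h ∩ (fun q : TM E M => q.proj) ⁻¹' L ⊆ K) ⟨∅, isCompact_empty, by simp⟩ ?_ ?_ ?_
  · rintro s t hst ⟨K, hK, hKt⟩
    exact ⟨K, hK, (inter_subset_inter_right _ (preimage_mono hst)).trans hKt⟩
  · rintro s t ⟨K, hK, hKs⟩ ⟨K', hK', hKt⟩
    refine ⟨K ∪ K', hK.union hK', ?_⟩
    rw [preimage_union, inter_union_distrib_left]
    exact union_subset_union hKs hKt
  · intro x _
    set p : TM E M := ⟨x, 0⟩
    set φ := extChartAt 𝓘(ℝ, E).tangent p with hφ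
    obtain ⟨r, hr, hrt⟩ := Metric.nhds_basis_closedBall.mem_iff.1
      (extChartAt_target_mem_nhds (I := 𝓘(ℝ, E)) x)
    set B := closedBall (extChartAt 𝓘(ℝ, E) x x) r with hB
    have hBc : IsCompact B := isCompact_closedBall _ _
    have htarget : ∀ K : Set E, B ×ˢ K ⊆ φ.target := fun K z hz =>
      mem_extChartAt_TM_target.2 (hrt hz.1)
    have hcomp : ∀ K : Set E, IsCompact K → IsCompact (φ.symm '' (B ×ˢ K)) := fun K hK =>
      (hBc.prod hK).image_of_continuousOn ((continuousOn_extChartAt_symm p).mono (htarget K))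
    have hvel : ∀ z ∈ φ.target, z.2 ≠ 0 → vel (φ.symm z) ≠ 0 := by
      intro z hz hz0 h0
      have h1 := extChartAt_TM_scale p 0 (φ.symm z)
      have h2 : scale 0 (φ.symm z) = φ.symm z :=
        congrArg (TotalSpace.mk (φ.symm z).proj) ((zero_smul ℝ (vel (φ.symm z))).trans h0.symm)
      rw [h2, ← hφ, φ.right_inv hz] at h1
      exact hz0 ((congrArg Prod.snd h1).trans (zero_smul ℝ z.2))
    -- the metric is bounded below on the unit vectors of the model space
    obtain ⟨a, ha, hale⟩ := (hcomp _ (isCompact_sphere (0 : E) 1)).exists_forall_le'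
      (a := 0) (continuous_len h).continuousOn (by
        rintro _ ⟨z, hz, rfl⟩
        refine len_pos h (hvel z (htarget _ hz) ?_)
        have hz2 := hz.2
        rw [mem_sphere_zero_iff_norm] at hz2
        exact norm_ne_zero_iff.1 (by rw [hz2]; exact one_ne_zero))
    refine ⟨(extChartAt 𝓘(ℝ, E) x).source ∩ extChartAt 𝓘(ℝ, E) x ⁻¹' B, ?_,
      φ.symm '' (B ×ˢ closedBall 0 a⁻¹), hcomp _ (isCompact_closedBall _ _), ?_⟩
    · refine mem_nhdsWithin_of_mem_nhds (inter_mem (extChartAt_source_mem_nhds x) ?_)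
      exact (continuousAt_extChartAt x).preimage_mem_nhds (closedBall_mem_nhds _ hr)
    · rintro q ⟨hq1, hqs, hqB⟩
      have hqφ : q ∈ φ.source := mem_extChartAt_TM_source.2 hqs
      refine ⟨φ q, ⟨hqB, ?_⟩, φ.left_inv hqφ⟩
      rw [mem_closedBall_zero_iff]
      by_contra! hlt
      have hpos : 0 < ‖(φ q).2‖ := (inv_pos.2 ha).trans hlt
      have h1 : φ.symm ((φ q).1, ‖(φ q).2‖⁻¹ • (φ q).2) = scale ‖(φ q).2‖⁻¹ q := by
        rw [← scaleCLM_apply, hφ, ← extChartAt_TM_scale, ← hφ]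
        exact φ.left_inv (mem_extChartAt_TM_source.2 hqs)
      have h2 := hale _ ⟨((φ q).1, ‖(φ q).2‖⁻¹ • (φ q).2), ⟨hqB, by
        rw [mem_sphere_zero_iff_norm, norm_smul, norm_inv, norm_norm,
          inv_mul_cancel₀ hpos.ne']⟩, rfl⟩
      rw [h1, len_scale h (inv_nonneg.2 hpos.le), (mem_unitBundle_iff h).1 hq1, mul_one] at h2
      exact absurd (inv_lt_of_inv_lt₀ ha hlt) (not_lt.2 h2)

end

/-! ### Curves of homogeneous fields, and closeness of sprays over a set -/

section

variable {E : Type*} [NormedAddCommGroup E] [NormedSpace ℝ E]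
  {M : Type*} [TopologicalSpace M] [ChartedSpace E M] [IsManifold 𝓘(ℝ, E) ∞ M]

/-- If `γ` is an integral curve of a homogeneous field then so is `t ↦ c • γ (c t)`. -/
theorem IsCurveFrom.scale {w : (v : TM E M) → TangentSpace 𝓘(ℝ, E).tangent v} (hw : IsScaling w)
    {u : TM E M} {γ : ℝ → TM E M} {J : Set ℝ} (hγ : IsCurveFrom w u γ J) {c : ℝ} (hc : 0 < c) :
    IsCurveFrom w (scale c u) (fun t => Spr.scale c (γ (t * c))) {t | t * c ∈ J} where
  isOpen := hγ.isOpen.preimage (continuous_mul_const c)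
  ordConnected := ⟨fun a ha b hb t ht => hγ.ordConnected.out ha hb
    ⟨mul_le_mul_of_nonneg_right ht.1 hc.le, mul_le_mul_of_nonneg_right ht.2 hc.le⟩⟩
  zero_mem := by
    rw [mem_ofPred_eq, zero_mul]; exact hγ.zero_mem
  map_zero := by rw [zero_mul, hγ.map_zero]
  curve := by
    intro t ht
    have h1 := hγ.curve.comp_mul c t ht
    have h2 := (hasMFDerivAt_scale c (γ (t * c))).comp_hasMFDerivWithinAt t h1
    have h3 : ∀ z z' : E × E, z' = c • scaleCLM E c z →
        (scaleCLM E c).comp ((1 : ℝ →L[ℝ] ℝ).smulRight (c • z)) =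
          (1 : ℝ →L[ℝ] ℝ).smulRight z' := by
      rintro z z' rfl
      ext <;> simp
    exact h2.congr_mfderiv (h3 (w (γ (t * c))) _ (hw c hc (γ (t * c))))

theorem IsForwardMaximal.scale {w : (v : TM E M) → TangentSpace 𝓘(ℝ, E).tangent v}
    (hw : IsScaling w) {u : TM E M} {γ : ℝ → TM E M} {J : Set ℝ} (hγ : IsForwardMaximal w u γ J)
    {c : ℝ} (hc : 0 < c) :
    IsForwardMaximal w (Spr.scale c u) (fun t => Spr.scale c (γ (t * c))) {t | t * c ∈ J} where
  toIsCurveFrom := hγ.toIsCurveFrom.scale hw hc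
  maximal := by
    intro γ' J' h' t ht ht0
    have h1 := h'.scale hw (inv_pos.2 hc)
    rw [scale_scale, inv_mul_cancel₀ hc.ne', scale_one] at h1
    refine hγ.maximal _ _ h1 (t * c) ?_ (mul_nonneg ht0 hc.le)
    rwa [mem_ofPred_eq, mul_assoc, mul_inv_cancel₀ hc.ne', mul_one]

theorem IsScaling.eq_zero {w : (v : TM E M) → TangentSpace 𝓘(ℝ, E).tangent v} (hw : IsScaling w)
    {q : TM E M} (hq : vel q = 0) : w q = 0 := by
  have h1 : ∀ z : E × E, z = (2 : ℝ) • scaleCLM E 2 z → z = 0 := by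
    rintro ⟨a, b⟩ hz
    have ha : a = (2 : ℝ) • a := congrArg Prod.fst hz
    have hb : b = (2 : ℝ) • (2 : ℝ) • b := congrArg Prod.snd hz
    rw [two_smul, left_eq_add] at ha
    rw [smul_smul, eq_comm, ← sub_eq_zero, ← one_smul ℝ b, smul_smul, ← sub_smul, smul_eq_zero] at hb
    exact Prod.ext ha (hb.resolve_left (by norm_num))
  have h2 : Spr.scale 2 q = q := by
    refine congrArg (TotalSpace.mk q.proj) ?_
    exact (congrArg (fun y : E => (2 : ℝ) • y) hq).trans ((smul_zero (2 : ℝ)).trans hq.symm)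
  refine h1 _ ?_
  have h3 := hw 2 two_pos q
  rw [h2] at h3
  exact h3

theorem IsScaling.isCurveFrom_const {w : (v : TM E M) → TangentSpace 𝓘(ℝ, E).tangent v}
    (hw : IsScaling w) {q : TM E M} (hq : vel q = 0) : IsCurveFrom w q (fun _ => q) univ where
  isOpen := isOpen_univ
  ordConnected := ordConnected_univ
  zero_mem := mem_univ _
  curve := (isMIntegralCurve_const (hw.eq_zero hq)).isMIntegralCurveOn univ
  map_zero := rfl

/-- Integral curves of a homogeneous field do not reach the zero section in finite time. -/
theorem IsCurveFrom.vel_ne_zero [FiniteDimensional ℝ E] [T2Space M]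
    {w : (v : TM E M) → TangentSpace 𝓘(ℝ, E).tangent v}
    (hws : ContMDiff 𝓘(ℝ, E).tangent 𝓘(ℝ, E).tangent.tangent 1
      (fun x => (⟨x, w x⟩ : TangentBundle 𝓘(ℝ, E).tangent (TM E M))))
    (hw : IsScaling w) {u : TM E M} {γ : ℝ → TM E M} {J : Set ℝ} (hγ : IsCurveFrom w u γ J)
    (hu : vel u ≠ 0) {t : ℝ} (ht : t ∈ J) : vel (γ t) ≠ 0 := by
  have : T2Space (TM E M) := t2Space_TM
  intro h0
  have h1 := (hγ.shift ht).eqOn hws (hw.isCurveFrom_const h0) (x := -t)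
    ⟨by rw [mem_ofPred_eq, neg_add_cancel]; exact hγ.zero_mem, mem_univ _⟩
  simp only [neg_add_cancel, hγ.map_zero] at h1
  rw [← h1] at h0
  exact hu h0

section Near

variable (h : ContMDiffRiemannianMetric 𝓘(ℝ, E) ∞ E (fun x : M => TangentSpace 𝓘(ℝ, E) x))
  {m : ℝ}

/-- The filter of neighbourhoods of `S`, as far as its values on the unit vectors over `L` are
concerned: it is generated by the sets of all `S'` whose graph over the unit vectors over `L` lies
in a given open subset of `TTM` that contains the corresponding part of the graph of `S`. -/
def nearOver (L : Set M) (S : HomSpray E M m) : Filter (HomSpray E M m) where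
  sets := {T | ∃ O : Set (TTM E M), IsOpen O ∧
    (∀ u ∈ unitBundle h, u.proj ∈ L → (⟨u, S.1.field u⟩ : TTM E M) ∈ O) ∧
    ∀ S' : HomSpray E M m,
      (∀ u ∈ unitBundle h, u.proj ∈ L → (⟨u, S'.1.field u⟩ : TTM E M) ∈ O) → S' ∈ T}
  univ_sets := ⟨univ, isOpen_univ, fun _ _ _ => mem_univ _, fun _ _ => mem_univ _⟩
  sets_of_superset := by
    rintro T T' ⟨O, hO, hS, hT⟩ hTT'
    exact ⟨O, hO, hS, fun S' hS' => hTT' (hT S' hS')⟩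
  inter_sets := by
    rintro T T' ⟨O, hO, hS, hT⟩ ⟨O', hO', hS', hT'⟩
    exact ⟨O ∩ O', hO.inter hO', fun u hu hL => ⟨hS u hu hL, hS' u hu hL⟩, fun S'' h'' =>
      ⟨hT S'' fun u hu hL => (h'' u hu hL).1, hT' S'' fun u hu hL => (h'' u hu hL).2⟩⟩

theorem eventually_nearOver {L : Set M} {S : HomSpray E M m} {P : HomSpray E M m → Prop} :
    (∀ᶠ S' in nearOver h L S, P S') ↔ ∃ O : Set (TTM E M), IsOpen O ∧
      (∀ u ∈ unitBundle h, u.proj ∈ L → (⟨u, S.1.field u⟩ : TTM E M) ∈ O) ∧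
      ∀ S' : HomSpray E M m,
        (∀ u ∈ unitBundle h, u.proj ∈ L → (⟨u, S'.1.field u⟩ : TTM E M) ∈ O) → P S' :=
  Iff.rfl

/-- Closeness on the unit vectors over `L` gives, by homogeneity, locally uniform closeness on all
nonzero vectors over `L`. -/
theorem locallyConverges_nearOver [FiniteDimensional ℝ E] [T2Space M] (L : Set M)
    (S : HomSpray E M m) :
    LocallyConverges 𝓘(ℝ, E).tangent (fun S' : HomSpray E M m => S'.1.field) S.1.field
      (nearOver h L S) {q | q.proj ∈ L ∧ vel q ≠ 0} {q | vel q ≠ 0} := by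
  have : LocallyCompactSpace M := Manifold.locallyCompact_of_finiteDimensional 𝓘(ℝ, E)
  intro p _
  set x := p.proj
  obtain ⟨V, hVx, hVc, hVs⟩ := exists_mem_nhds_isClosed_subset
    (extChartAt_source_mem_nhds (I := 𝓘(ℝ, E)) x)
  set Λ := len h p + 1 with hΛ
  have hΛ1 : 1 ≤ Λ := le_add_of_nonneg_left (Real.sqrt_nonneg _)
  refine ⟨(fun q : TM E M => q.proj) ⁻¹' V ∩ {q | len h q < Λ}, inter_mem
    (continuous_proj_TM.continuousAt.preimage_mem_nhds hVx)
    ((isOpen_lt (continuous_len h) continuous_const).mem_nhds (lt_add_one (len h p))), ?_⟩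
  rw [Metric.tendstoUniformlyOn_iff]
  intro ε hε
  have hδ : 0 < ε / (Λ * Λ) := by positivity
  set e := trivializationAt (E × E) (TangentSpace 𝓘(ℝ, E).tangent) p
  set N : Set (TTM E M) := {ξ | ξ.proj.proj ∈ (extChartAt 𝓘(ℝ, E) x).source} with hN
  have hNe : N = e.source := by
    ext ξ
    rw [hN, mem_ofPred_eq, ← mem_extChartAt_TM_source, extChartAt_source, Trivialization.mem_source]
    rfl
  have hNo : IsOpen N := by rw [hNe]; exact e.open_source
  have hcont : ContinuousOn (fun ξ : TTM E M =>
      dist (e ⟨ξ.proj, S.1.field ξ.proj⟩).2 (e ξ).2) N := by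
    refine continuous_dist.comp_continuousOn (ContinuousOn.prodMk ?_ ?_)
    · refine continuous_snd.comp_continuousOn (e.continuousOn_toFun.comp
        ((S.1.smooth.continuous.comp (FiberBundle.continuous_proj (E × E)
          (TangentSpace 𝓘(ℝ, E).tangent))).continuousOn) ?_)
      intro ξ hξ
      rw [hNe] at hξ
      exact e.mem_source.2 (e.mem_source.1 hξ)
    · rw [hNe]
      exact continuous_snd.comp_continuousOn e.continuousOn_toFun
  rw [eventually_nearOver]
  refine ⟨{ξ | ξ.proj.proj ∉ V} ∪ (N ∩ (fun ξ : TTM E M =>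
      dist (e ⟨ξ.proj, S.1.field ξ.proj⟩).2 (e ξ).2) ⁻¹' Iio (ε / (Λ * Λ))), ?_, ?_, ?_⟩
  · refine IsOpen.union ?_ (hcont.isOpen_inter_preimage hNo isOpen_Iio)
    exact hVc.isOpen_compl.preimage (continuous_proj_TM.comp
      (FiberBundle.continuous_proj (E × E) (TangentSpace 𝓘(ℝ, E).tangent)))
  · intro u _ _
    by_cases hu : u.proj ∈ V
    · refine Or.inr ⟨hVs hu, ?_⟩
      rw [mem_preimage, dist_self]
      exact hδ
    · exact Or.inl hu
  · rintro S' hS' q ⟨⟨hqV, hqΛ⟩, hqL, hq0⟩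
    set l := len h q
    have hl : 0 < l := len_pos h hq0
    set u := scale l⁻¹ q with hu
    have hq : q = scale l u := by
      rw [hu, scale_scale, mul_inv_cancel₀ hl.ne', scale_one]
    have huU : u ∈ unitBundle h := by
      rw [mem_unitBundle_iff, hu, len_scale h (inv_pos.2 hl).le, inv_mul_cancel₀ hl.ne']
    have h1 : dist (fieldInChart 𝓘(ℝ, E).tangent p S.1.field u)
        (fieldInChart 𝓘(ℝ, E).tangent p S'.1.field u) < ε / (Λ * Λ) :=
      ((hS' u huU hqL).resolve_left (fun hc => hc hqV)).2
    rw [hq]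
    refine (congrArg₂ dist (S.2.isScaling.fieldInChart_scale hl p (q := u) (hVs hqV))
      (S'.2.isScaling.fieldInChart_scale hl p (q := u) (hVs hqV))).trans_lt ?_
    rw [dist_eq_norm] at h1 ⊢
    rw [← smul_sub, ← map_sub, norm_smul, Real.norm_of_nonneg hl.le]
    set z := fieldInChart 𝓘(ℝ, E).tangent p S.1.field u -
      fieldInChart 𝓘(ℝ, E).tangent p S'.1.field u
    have h2 : ‖scaleCLM E l z‖ ≤ Λ * ‖z‖ := by
      rw [scaleCLM_apply, Prod.norm_mk, norm_smul, Real.norm_of_nonneg hl.le]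
      refine max_le ?_ ?_
      · exact (norm_fst_le z).trans (le_mul_of_one_le_left (norm_nonneg _) hΛ1)
      · exact mul_le_mul hqΛ.le (norm_snd_le z) (norm_nonneg _) (by positivity)
    calc l * ‖scaleCLM E l z‖ ≤ Λ * (Λ * ‖z‖) :=
          mul_le_mul hqΛ.le h2 (norm_nonneg _) (by positivity)
      _ = Λ * Λ * ‖z‖ := by ring
      _ < Λ * Λ * (ε / (Λ * Λ)) := by gcongr
      _ = ε := by field_simp

end Near

end

/-! ### Trapped curves -/

section

variable {E : Type*} [NormedAddCommGroup E] [NormedSpace ℝ E]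
  {M : Type*} [TopologicalSpace M] [ChartedSpace E M] [IsManifold 𝓘(ℝ, E) ∞ M]

/-- The set `L` traps an integral curve of `v`: the maximal curve from some nonzero vector lies over
`L` for all times, past and future. -/
def Traps (v : (q : TM E M) → TangentSpace 𝓘(ℝ, E).tangent q) (L : Set M) : Prop :=
  ∃ u : TM E M, vel u ≠ 0 ∧ ∀ γ J, IsCurveFrom v u γ J → ∀ t ∈ J, (γ t).proj ∈ L

/-- Each forward maximal integral curve of `v` from a nonzero vector leaves `L`. -/
def Escapes (v : (q : TM E M) → TangentSpace 𝓘(ℝ, E).tangent q) (L : Set M) : Prop :=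
  ∀ u γ J, IsForwardMaximal v u γ J → vel u ≠ 0 → ∃ t ∈ J, 0 ≤ t ∧ (γ t).proj ∉ L

theorem Traps.of_neg {v : (q : TM E M) → TangentSpace 𝓘(ℝ, E).tangent q} {L : Set M}
    (h : Traps (-v) L) : Traps v L := by
  obtain ⟨u, hu, hL⟩ := h
  refine ⟨u, hu, fun γ J hγ t ht => ?_⟩
  have := hL _ _ hγ.reverse (-t) (by rwa [mem_ofPred_eq, neg_neg])
  simpa only [neg_neg] using this

variable [FiniteDimensional ℝ E] [T2Space M]

theorem IsForwardMaximal.shift {v : (q : TM E M) → TangentSpace 𝓘(ℝ, E).tangent q}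
    (hv : ContMDiff 𝓘(ℝ, E).tangent 𝓘(ℝ, E).tangent.tangent 1
      (fun x => (⟨x, v x⟩ : TangentBundle 𝓘(ℝ, E).tangent (TM E M))))
    {u : TM E M} {γ : ℝ → TM E M} {J : Set ℝ} (hγ : IsForwardMaximal v u γ J) {τ : ℝ} (hτ : τ ∈ J)
    (hτ0 : 0 ≤ τ) : IsForwardMaximal v (γ τ) (fun t => γ (t + τ)) {t | t + τ ∈ J} where
  toIsCurveFrom := hγ.toIsCurveFrom.shift hτ
  maximal := by
    intro γ' J' h' t ht ht0
    have : T2Space (TM E M) := t2Space_TM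
    rw [mem_ofPred_eq, add_comm]
    exact hγ.add_mem hv hτ h' ht (by positivity)

/-- If a curve stays over the compact set `L` for all positive times, then so does, for all times,
the curve from a limit direction: rescale the tails of the curve to start at unit vectors. -/
theorem escapes_of_not_traps
    (h : ContMDiffRiemannianMetric 𝓘(ℝ, E) ∞ E (fun x : M => TangentSpace 𝓘(ℝ, E) x))
    {v : (q : TM E M) → TangentSpace 𝓘(ℝ, E).tangent q}
    (hv : ContMDiff 𝓘(ℝ, E).tangent 𝓘(ℝ, E).tangent.tangent 1
      (fun x => (⟨x, v x⟩ : TangentBundle 𝓘(ℝ, E).tangent (TM E M))))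
    (hvs : IsScaling v) {L : Set M} (hL : IsCompact L) (hno : ¬ Traps v L) : Escapes v L := by
  have : T2Space (TM E M) := t2Space_TM
  intro u₀ γ J hγ hu₀
  by_contra! hstay
  refine hno ?_
  let T := {t : ℝ // t ∈ J ∧ 0 ≤ t}
  have : Nonempty T := ⟨⟨0, hγ.zero_mem, le_rfl⟩⟩
  let l : Ultrafilter T := Ultrafilter.of atTop
  have hl : (l : Filter T) ≤ atTop := Ultrafilter.of_le atTop
  set lam : T → ℝ := fun t => len h (γ t.1) with hlam
  have hvel : ∀ t : T, vel (γ t.1) ≠ 0 := fun t => hγ.vel_ne_zero hv hvs hu₀ t.2.1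
  have hlam0 : ∀ t, 0 < lam t := fun t => len_pos h (hvel t)
  set x : T → TM E M := fun t => scale (lam t)⁻¹ (γ t.1) with hx
  have hxU : ∀ t, x t ∈ unitBundle h ∩ (fun q : TM E M => q.proj) ⁻¹' L := fun t =>
    ⟨(mem_unitBundle_iff h).2 ((len_scale h (inv_pos.2 (hlam0 t)).le _).trans
      (inv_mul_cancel₀ (hlam0 t).ne')), hstay t.1 t.2.1 t.2.2⟩
  obtain ⟨u, ⟨huU, huL⟩, hul⟩ := (isCompact_unitBundle_inter h hL).ultrafilter_le_nhds (l.map x) (by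
    rw [Ultrafilter.coe_map, le_principal_iff, mem_map]
    exact Eventually.of_forall hxU)
  have hu1 : len h u = 1 := (mem_unitBundle_iff h).1 huU
  have hu0 : vel u ≠ 0 := vel_ne_zero_of_len h (by rw [hu1]; exact one_ne_zero)
  refine ⟨u, hu0, fun β D hβ s hs => ?_⟩
  -- the rescaled tails of the curve
  set α : T → ℝ → TM E M := fun t r => scale (lam t)⁻¹ (γ (r * (lam t)⁻¹ + t.1)) with hα
  set Dα : T → Set ℝ := fun t => {r | r * (lam t)⁻¹ + t.1 ∈ J} with hDα
  have hαf : ∀ t, IsForwardMaximal v (x t) (α t) (Dα t) := fun t =>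
    (hγ.shift hv t.2.1 t.2.2).scale hvs (inv_pos.2 (hlam0 t))
  have hcl : ∀ y : T → TM E M, (∀ᶠ t in (l : Filter T), (y t).proj ∈ L) → ∀ q,
      Tendsto y l (𝓝 q) → q.proj ∈ L := fun y hy q hq =>
    hL.isClosed.mem_of_tendsto ((continuous_proj_TM.tendsto q).comp hq) hy
  have hxu : Tendsto x l (𝓝 u) := hul
  rcases le_total 0 s with hs0 | hs0
  · have hev : ∀ᶠ t in (l : Filter T), s ∈ Dα t :=
      eventually_mem_of_locallyConverges (w := fun _ => v) (A := univ) (P := univ) (x := x)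
        (γ := α) hv (Eventually.of_forall fun _ => hv) (locallyConverges_const v (l : Filter T) univ univ) hβ
        (fun _ _ => mem_univ _) (Eventually.of_forall fun t => ⟨hαf t, fun _ _ _ => mem_univ _⟩)
        hxu hs hs0
    have hlim : Tendsto (fun t => α t s) l (𝓝 (β s)) := by
      refine tendsto_of_locallyConverges (w := fun _ => v) (A := univ) (P := univ) (γ := α)
        (τ := fun _ => s) hv (locallyConverges_const v (l : Filter T) univ univ) hβ (fun _ _ => mem_univ _) ?_
        (hxu.congr fun t => (hαf t).map_zero.symm) hs tendsto_const_nhds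
      filter_upwards [hev] with t ht
      exact ⟨hs0, (hαf t).curve.mono ((hαf t).Icc_subset ht), fun _ _ => mem_univ _⟩
    refine hcl _ ?_ _ hlim
    filter_upwards [hev] with t ht
    exact hstay _ ht (add_nonneg (mul_nonneg hs0 (inv_pos.2 (hlam0 t)).le) t.2.2)
  · have hback : ∀ (r : T → ℝ), (∀ᶠ t in (l : Filter T), 0 ≤ r t ∧ r t * (lam t)⁻¹ ≤ t.1) →
        ∀ r₀, -r₀ ∈ D → Tendsto r l (𝓝 r₀) → Tendsto (fun t => α t (-r t)) l (𝓝 (β (-r₀))) := by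
      intro r hr r₀ hr₀ hrl
      refine tendsto_of_locallyConverges (w := fun _ => -v) (A := univ) (P := univ)
        (γ := fun t ρ => α t (-ρ)) (τ := r) (contMDiff_neg_field hv)
        (locallyConverges_const (-v) (l : Filter T) univ univ) hβ.reverse (fun _ _ => mem_univ _) ?_ ?_ hr₀ hrl
      · filter_upwards [hr] with t ht
        refine ⟨ht.1, (hαf t).reverse.curve.mono ((hαf t).reverse.Icc_subset ?_),
          fun _ _ => mem_univ _⟩
        refine hγ.Icc_subset t.2.1 ⟨?_, ?_⟩
        · rw [neg_mul]; linarith [ht.2]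
        · rw [neg_mul]; linarith [mul_nonneg ht.1 (inv_pos.2 (hlam0 t)).le]
      · simp only [neg_zero]
        exact hxu.congr fun t => (hαf t).map_zero.symm
    have hdich := l.eventually_or (p := fun t => -s * (lam t)⁻¹ ≤ t.1)
      (q := fun t => t.1 < -s * (lam t)⁻¹)
    rcases hdich.1 (Eventually.of_forall fun t => le_or_gt _ _) with hev | hev
    · have hlim := hback (fun _ => -s) (hev.mono fun t ht => ⟨neg_nonneg.2 hs0, ht⟩) (-s)
        (by rwa [neg_neg]) tendsto_const_nhds
      simp only [neg_neg] at hlim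
      refine hcl _ ?_ _ hlim
      filter_upwards [hev] with t ht
      have h1 : 0 ≤ s * (lam t)⁻¹ + t.1 := by linarith
      refine hstay _ (hγ.Icc_subset t.2.1 ⟨h1, ?_⟩) h1
      linarith [mul_nonpos_of_nonpos_of_nonneg hs0 (inv_pos.2 (hlam0 t)).le]
    -- otherwise the lengths and the times converge, so the curve could be continued
    · exfalso
      set r : T → ℝ := fun t => t.1 * lam t with hr
      have hrle : ∀ t, r t * (lam t)⁻¹ = t.1 := fun t => mul_inv_cancel_right₀ (hlam0 t).ne' _
      have hr0 : ∀ t, 0 ≤ r t := fun t => mul_nonneg t.2.2 (hlam0 t).le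
      obtain ⟨r₀, hr₀, hrl⟩ := (isCompact_Icc (a := (0 : ℝ)) (b := -s)).ultrafilter_le_nhds
        (l.map r) (by
          rw [Ultrafilter.coe_map, le_principal_iff, mem_map]
          filter_upwards [hev] with t ht
          refine ⟨hr0 t, ?_⟩
          rw [← div_eq_mul_inv, lt_div_iff₀ (hlam0 t)] at ht
          exact ht.le)
      have hrD : -r₀ ∈ D :=
        hβ.ordConnected.out hs hβ.zero_mem ⟨by linarith [hr₀.2], by linarith [hr₀.1]⟩
      have hlim := hback r (Eventually.of_forall fun t => ⟨hr0 t, (hrle t).le⟩) r₀ hrD hrl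
      have hval : ∀ t, α t (-r t) = scale (lam t)⁻¹ u₀ := by
        intro t
        rw [hα]
        beta_reduce
        rw [neg_mul, hrle, neg_add_cancel, hγ.map_zero]
      simp only [hval] at hlim
      have hlen := ((continuous_len h).tendsto _).comp hlim
      have hlen' : Tendsto (fun t => (lam t)⁻¹ * len h u₀) l (𝓝 (len h (β (-r₀)))) :=
        hlen.congr fun t => len_scale h (inv_pos.2 (hlam0 t)).le u₀
      have hβ0 : 0 < len h (β (-r₀)) := len_pos h (hβ.vel_ne_zero hv hvs hu0 hrD)
      have hu₀l : 0 < len h u₀ := len_pos h hu₀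
      set lam₀ := (len h (β (-r₀)))⁻¹ * len h u₀
      have hlam₀ : 0 < lam₀ := mul_pos (inv_pos.2 hβ0) hu₀l
      have hlaml : Tendsto lam l (𝓝 lam₀) := by
        refine ((hlen'.inv₀ hβ0.ne').mul_const (len h u₀)).congr fun t => ?_
        rw [mul_inv, inv_inv, mul_assoc, inv_mul_cancel₀ hu₀l.ne', mul_one]
      have htl : Tendsto (fun t : T => t.1) l (𝓝 (r₀ / lam₀)) :=
        (Tendsto.div hrl hlaml hlam₀.ne').congr fun t =>
          (div_eq_mul_inv _ _).trans (hrle t)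
      have hγl : Tendsto (fun t : T => γ t.1) l (𝓝 (scale lam₀ u)) := by
        refine ((continuous_scale.tendsto (lam₀, u)).comp (hlaml.prodMk_nhds hxu)).congr fun t => ?_
        simp only [Function.comp_apply, hx, scale_scale, mul_inv_cancel₀ (hlam0 t).ne', scale_one]
      obtain ⟨V, hV, δ, hδ, hVδ⟩ := exists_nhds_forall_isForwardMaximal_add_mem hv (scale lam₀ u)
      have hclose : ∀ᶠ t : T in (l : Filter T), dist t.1 (r₀ / lam₀) < δ / 2 :=
        htl.eventually (ball_mem_nhds _ (half_pos hδ))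
      obtain ⟨t, ht1, ht2⟩ := ((hγl.eventually hV).and hclose).exists
      let t' : T := ⟨t.1 + δ, hVδ _ _ _ hγ t.1 t.2.1 t.2.2 ht1, add_nonneg t.2.2 hδ.le⟩
      obtain ⟨t'', h1, h2⟩ := (hclose.and (hl (eventually_ge_atTop t'))).exists
      have h3 : t.1 + δ ≤ t''.1 := h2
      rw [Real.dist_eq, abs_lt] at ht2 h1
      linarith [ht2.1, h1.2]

section Limits

variable {ι : Type*} {l : Ultrafilter ι}
  {v : (q : TM E M) → TangentSpace 𝓘(ℝ, E).tangent q}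
  {w : ι → (q : TM E M) → TangentSpace 𝓘(ℝ, E).tangent q}

/-- Curves over `L` that end over the closed set `A` converge to a curve that meets `A`, if the
limit curve leaves `L`. -/
theorem exists_proj_mem_of_locallyConverges
    (hv : ContMDiff 𝓘(ℝ, E).tangent 𝓘(ℝ, E).tangent.tangent 1
      (fun x => (⟨x, v x⟩ : TangentBundle 𝓘(ℝ, E).tangent (TM E M))))
    (hvs : IsScaling v) {L A : Set M} (hL : IsClosed L) (hA : IsClosed A)
    (hw : LocallyConverges 𝓘(ℝ, E).tangent w v l {q | q.proj ∈ L ∧ vel q ≠ 0} {q | vel q ≠ 0})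
    {x : TM E M} (hx : vel x ≠ 0) {β : ℝ → TM E M} {D : Set ℝ} (hβ : IsCurveFrom v x β D)
    (hesc : ∃ s ∈ D, 0 ≤ s ∧ (β s).proj ∉ L) {γ : ι → ℝ → TM E M} {c : ι → ℝ}
    (hγ : ∀ᶠ i in (l : Filter ι), 0 ≤ c i ∧ IsMIntegralCurveOn (γ i) (w i) (Icc 0 (c i)) ∧
      ∀ r ∈ Icc 0 (c i), (γ i r).proj ∈ L ∧ vel (γ i r) ≠ 0)
    (h0 : Tendsto (fun i => γ i 0) l (𝓝 x)) (hend : ∀ᶠ i in (l : Filter ι), (γ i (c i)).proj ∈ A) :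
    ∃ s ∈ D, 0 ≤ s ∧ (β s).proj ∈ A := by
  have : T2Space (TM E M) := t2Space_TM
  obtain ⟨s, hs, hs0, hsL⟩ := hesc
  have hP : ∀ t ∈ D, β t ∈ {q : TM E M | vel q ≠ 0} := fun t ht => hβ.vel_ne_zero hv hvs hx ht
  have hle : ∀ᶠ i in (l : Filter ι), c i ≤ s := by
    by_contra hcon
    rw [← Ultrafilter.eventually_not] at hcon
    have hlim : Tendsto (fun i => γ i s) l (𝓝 (β s)) := by
      refine tendsto_of_locallyConverges (τ := fun _ => s) hv hw hβ hP ?_ h0 hs tendsto_const_nhds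
      filter_upwards [hcon, hγ] with i h1 h2
      have hsub : Icc 0 s ⊆ Icc 0 (c i) := Icc_subset_Icc_right (not_le.1 h1).le
      exact ⟨hs0, h2.2.1.mono hsub, fun r hr => h2.2.2 r (hsub hr)⟩
    refine hsL (hL.mem_of_tendsto ((continuous_proj_TM.tendsto _).comp hlim) ?_)
    filter_upwards [hcon, hγ] with i h1 h2
    exact (h2.2.2 s ⟨hs0, (not_le.1 h1).le⟩).1
  obtain ⟨t, ht, htl⟩ := (isCompact_Icc (a := (0 : ℝ)) (b := s)).ultrafilter_le_nhds (l.map c) (by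
    rw [Ultrafilter.coe_map, le_principal_iff, mem_map]
    filter_upwards [hle, hγ] with i h1 h2
    exact ⟨h2.1, h1⟩)
  have htD := hβ.Icc_subset hs ht
  have hlim := tendsto_of_locallyConverges (τ := c) hv hw hβ hP hγ h0 htD htl
  exact ⟨t, htD, ht.1, hA.mem_of_tendsto ((continuous_proj_TM.tendsto _).comp hlim) hend⟩

end Limits

end

/-! ### Stability over a compact set -/

section

theorem LocallyConverges.mono_left {F : Type*} [NormedAddCommGroup F] [NormedSpace ℝ F]
    {H : Type*} [TopologicalSpace H] {I : ModelWithCorners ℝ F H} {X : Type*} [TopologicalSpace X]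
    [ChartedSpace H X] [IsManifold I 1 X] {ι : Type*} {w : ι → (x : X) → TangentSpace I x}
    {v : (x : X) → TangentSpace I x} {l l' : Filter ι} {A P : Set X}
    (h : LocallyConverges I w v l A P) (hl : l' ≤ l) : LocallyConverges I w v l' A P := by
  intro p hp
  obtain ⟨V, hV, h1⟩ := h p hp
  exact ⟨V, hV, fun u hu => hl (h1 u hu)⟩

variable {E : Type*} [NormedAddCommGroup E] [NormedSpace ℝ E]
  {M : Type*} [TopologicalSpace M] [ChartedSpace E M] [IsManifold 𝓘(ℝ, E) ∞ M]

theorem Spray.contMDiff_one (S : Spray E M) :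
    ContMDiff 𝓘(ℝ, E).tangent 𝓘(ℝ, E).tangent.tangent 1
      (fun x => (⟨x, S.field x⟩ : TangentBundle 𝓘(ℝ, E).tangent (TM E M))) :=
  S.smooth.of_le (by norm_num)

variable (h : ContMDiffRiemannianMetric 𝓘(ℝ, E) ∞ E (fun x : M => TangentSpace 𝓘(ℝ, E) x))
  {m : ℝ}

theorem scale_inv_len_mem_unitBundle {u : TM E M} (hu : vel u ≠ 0) :
    scale (len h u)⁻¹ u ∈ unitBundle h :=
  (mem_unitBundle_iff h).2 ((len_scale h (inv_pos.2 (len_pos h hu)).le u).trans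
    (inv_mul_cancel₀ (len_pos h hu).ne'))

variable [FiniteDimensional ℝ E] [T2Space M]

/-- Trapping no curve over a compact set is stable under perturbations. -/
theorem eventually_not_traps {L : Set M} (hL : IsCompact L) (S : HomSpray E M m)
    (hesc : Escapes S.1.field L) : ∀ᶠ S' in nearOver h L S, ¬ Traps S'.1.field L := by
  have : T2Space (TM E M) := t2Space_TM
  refine Filter.mem_iff_ultrafilter.2 fun l hl => ?_
  by_contra hcon
  have hcon' : ∀ᶠ S' in (l : Filter (HomSpray E M m)), Traps S'.1.field L :=
    (Ultrafilter.eventually_not.2 hcon).mono fun _ h => not_not.1 h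
  -- normalize the initial vectors of the trapped curves
  have hex : ∀ᶠ S' in (l : Filter (HomSpray E M m)), ∃ d : TM E M × (ℝ → TM E M) × Set ℝ,
      d.1 ∈ unitBundle h ∧ IsForwardMaximal S'.1.field d.1 d.2.1 d.2.2 ∧
        ∀ r ∈ d.2.2, (d.2.1 r).proj ∈ L := by
    filter_upwards [hcon'] with S' hS'
    obtain ⟨u, hu, hall⟩ := hS'
    obtain ⟨γ, J, hγ⟩ := exists_isForwardMaximal S'.1.contMDiff_one u
    exact ⟨(_, _, _), scale_inv_len_mem_unitBundle h hu,
      hγ.scale S'.2.isScaling (inv_pos.2 (len_pos h hu)), fun r hr => hall γ J hγ.1 _ hr⟩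
  have : Nonempty (TM E M × (ℝ → TM E M) × Set ℝ) := hex.exists.elim fun _ h => h.nonempty
  obtain ⟨d, hd⟩ := hex.choice
  have hw := (locallyConverges_nearOver h L S).mono_left hl
  obtain ⟨x, hx, hxl⟩ := (isCompact_unitBundle_inter h hL).ultrafilter_le_nhds
    (l.map fun S' => (d S').1) (by
      rw [Ultrafilter.coe_map, le_principal_iff, mem_map]
      filter_upwards [hd] with S' hS'
      refine ⟨hS'.1, ?_⟩
      have := hS'.2.2 0 hS'.2.1.zero_mem
      rwa [hS'.2.1.map_zero] at this)
  have hx0 : vel x ≠ 0 :=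
    vel_ne_zero_of_len h (by rw [(mem_unitBundle_iff h).1 hx.1]; exact one_ne_zero)
  obtain ⟨β, D, hβ⟩ := exists_isForwardMaximal S.1.contMDiff_one x
  obtain ⟨s, hs, hs0, hsL⟩ := hesc x β D hβ hx0
  have hP : ∀ t ∈ D, β t ∈ {q : TM E M | vel q ≠ 0} := fun t ht =>
    hβ.vel_ne_zero S.1.contMDiff_one S.2.isScaling hx0 ht
  have hA : ∀ᶠ S' in (l : Filter (HomSpray E M m)), ∀ r ∈ (d S').2.2,
      (d S').2.1 r ∈ {q : TM E M | q.proj ∈ L ∧ vel q ≠ 0} := by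
    filter_upwards [hd] with S' hS' r hr
    exact ⟨hS'.2.2 r hr, hS'.2.1.vel_ne_zero S'.1.contMDiff_one S'.2.isScaling
      (vel_ne_zero_of_len h (by rw [(mem_unitBundle_iff h).1 hS'.1]; exact one_ne_zero)) hr⟩
  have hmem := eventually_mem_of_locallyConverges S.1.contMDiff_one
    (Eventually.of_forall fun S' : HomSpray E M m => S'.1.contMDiff_one) hw hβ.toIsCurveFrom hP
    (hd.mp (hA.mono fun S' h1 h2 => ⟨h2.2.1, fun r hr _ => h1 r hr⟩)) hxl hs hs0
  have hlim : Tendsto (fun S' => (d S').2.1 s) l (𝓝 (β s)) := by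
    refine tendsto_of_locallyConverges (τ := fun _ => s) S.1.contMDiff_one hw hβ.toIsCurveFrom hP ?_
      ?_ hs tendsto_const_nhds
    · filter_upwards [hd, hmem, hA] with S' h1 h2 h3
      have hsub := h1.2.1.Icc_subset h2
      exact ⟨hs0, h1.2.1.curve.mono hsub, fun r hr => h3 r (hsub hr)⟩
    · exact Tendsto.congr' (hd.mono fun S' hS' => hS'.2.1.map_zero.symm) hxl
  refine hsL (hL.isClosed.mem_of_tendsto ((continuous_proj_TM.tendsto _).comp hlim) ?_)
  filter_upwards [hd, hmem] with S' h1 h2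
  exact h1.2.2 s h2

/-- Let `u` lie on an integral curve of `v` over the compact set `L` with both ends over the closed
set `A`. If for `v` this forces `u` to lie over the open set `U`, then it does for nearby fields. -/
theorem eventually_proj_mem_of_segment {L A U : Set M} (hL : IsCompact L) (hA : IsClosed A)
    (hU : IsOpen U) (S : HomSpray E M m) (hesc : Escapes S.1.field L)
    (hesc' : Escapes (-S.1.field) L)
    (hull : ∀ u γ J, IsCurveFrom S.1.field u γ J → ∀ a c, 0 ≤ a → 0 ≤ c → -a ∈ J → c ∈ J →
      (γ (-a)).proj ∈ A → (γ c).proj ∈ A → u.proj ∈ U) :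
    ∀ᶠ S' in nearOver h L S, ∀ u γ J, vel u ≠ 0 → IsCurveFrom S'.1.field u γ J →
      ∀ a c, 0 ≤ a → 0 ≤ c → -a ∈ J → c ∈ J → (∀ r ∈ Icc (-a) c, (γ r).proj ∈ L) →
        (γ (-a)).proj ∈ A → (γ c).proj ∈ A → u.proj ∈ U := by
  have : T2Space (TM E M) := t2Space_TM
  refine Filter.mem_iff_ultrafilter.2 fun l hl => ?_
  by_contra hcon
  have hcon' := Ultrafilter.eventually_not.2 hcon
  have hex : ∀ᶠ S' in (l : Filter (HomSpray E M m)),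
      ∃ d : TM E M × (ℝ → TM E M) × Set ℝ × ℝ × ℝ,
      d.1 ∈ unitBundle h ∧ IsCurveFrom S'.1.field d.1 d.2.1 d.2.2.1 ∧
        0 ≤ d.2.2.2.1 ∧ 0 ≤ d.2.2.2.2 ∧ -d.2.2.2.1 ∈ d.2.2.1 ∧ d.2.2.2.2 ∈ d.2.2.1 ∧
        (∀ r ∈ Icc (-d.2.2.2.1) d.2.2.2.2, (d.2.1 r).proj ∈ L) ∧
        (d.2.1 (-d.2.2.2.1)).proj ∈ A ∧ (d.2.1 d.2.2.2.2).proj ∈ A ∧ d.1.proj ∉ U := by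
    filter_upwards [hcon'] with S' hS'
    have hS'' : ¬ ∀ u γ J, vel u ≠ 0 → IsCurveFrom S'.1.field u γ J →
      ∀ a c, 0 ≤ a → 0 ≤ c → -a ∈ J → c ∈ J → (∀ r ∈ Icc (-a) c, (γ r).proj ∈ L) →
        (γ (-a)).proj ∈ A → (γ c).proj ∈ A → u.proj ∈ U := hS'
    push Not at hS''
    obtain ⟨u, γ, J, hu, hγ, a, c, ha, hc, haJ, hcJ, hr, haA, hcA, huU⟩ := hS''
    set k := len h u
    have hk : 0 < k := len_pos h hu
    have hka : -(a * k) * k⁻¹ = -a := by rw [← neg_mul, mul_inv_cancel_right₀ hk.ne']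
    have hkc : c * k * k⁻¹ = c := mul_inv_cancel_right₀ hk.ne' c
    refine ⟨(scale k⁻¹ u, fun t => scale k⁻¹ (γ (t * k⁻¹)), {t | t * k⁻¹ ∈ J}, a * k, c * k),
      scale_inv_len_mem_unitBundle h hu,
      hγ.scale S'.2.isScaling (inv_pos.2 hk), mul_nonneg ha hk.le, mul_nonneg hc hk.le, ?_, ?_, ?_,
      ?_, ?_, huU⟩
    · change -(a * k) * k⁻¹ ∈ J
      rwa [hka]
    · change c * k * k⁻¹ ∈ J
      rwa [hkc]
    · rintro r ⟨hr1, hr2⟩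
      refine hr _ ⟨?_, ?_⟩
      · rw [← div_eq_mul_inv, le_div_iff₀ hk, neg_mul]; exact hr1
      · rw [← div_eq_mul_inv, div_le_iff₀ hk]; exact hr2
    · change (γ (-(a * k) * k⁻¹)).proj ∈ A
      rwa [hka]
    · change (γ (c * k * k⁻¹)).proj ∈ A
      rwa [hkc]
  have : Nonempty (TM E M × (ℝ → TM E M) × Set ℝ × ℝ × ℝ) :=
    hex.exists.elim fun _ h => h.nonempty
  obtain ⟨d, hd⟩ := hex.choice
  have hw := (locallyConverges_nearOver h L S).mono_left hl
  obtain ⟨x, hx, hxl⟩ := ((isCompact_unitBundle_inter h hL).inter_right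
    (hU.isClosed_compl.preimage continuous_proj_TM)).ultrafilter_le_nhds
    (l.map fun S' => (d S').1) (by
      rw [Ultrafilter.coe_map, le_principal_iff, mem_map]
      filter_upwards [hd] with S' ⟨h1, h2, h3, h4, _, _, h5, _, _, h6⟩
      refine ⟨⟨h1, ?_⟩, h6⟩
      have := h5 0 ⟨neg_nonpos.2 h3, h4⟩
      rwa [h2.map_zero] at this)
  have hx0 : vel x ≠ 0 :=
    vel_ne_zero_of_len h (by rw [(mem_unitBundle_iff h).1 hx.1.1]; exact one_ne_zero)
  have hvel : ∀ᶠ S' in (l : Filter (HomSpray E M m)), ∀ r ∈ (d S').2.2.1,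
      vel ((d S').2.1 r) ≠ 0 := by
    filter_upwards [hd] with S' hS' r hr
    exact hS'.2.1.vel_ne_zero S'.1.contMDiff_one S'.2.isScaling
      (vel_ne_zero_of_len h (by rw [(mem_unitBundle_iff h).1 hS'.1]; exact one_ne_zero)) hr
  obtain ⟨β, D, hβ, hmax⟩ := exists_maximal_isCurveFrom S.1.contMDiff_one x
  have hβf : IsForwardMaximal S.1.field x β D := ⟨hβ, fun γ' J' h' t ht _ => hmax γ' J' h' ht⟩
  have hβb : IsForwardMaximal (-S.1.field) x (fun t => β (-t)) {t | -t ∈ D} := by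
    refine ⟨hβ.reverse, fun γ' J' h' t ht _ => ?_⟩
    have h1 := h'.reverse
    rw [neg_neg] at h1
    exact hmax _ _ h1 (show -t ∈ {t | -t ∈ J'} by rwa [mem_ofPred_eq, neg_neg])
  have hstart : Tendsto (fun S' => (d S').2.1 0) l (𝓝 x) :=
    Tendsto.congr' (hd.mono fun S' hS' => hS'.2.1.map_zero.symm) hxl
  obtain ⟨c, hc, hc0, hcA⟩ := exists_proj_mem_of_locallyConverges S.1.contMDiff_one S.2.isScaling
    hL.isClosed hA hw hx0 hβ (hesc x β D hβf hx0) (γ := fun S' => (d S').2.1)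
    (c := fun S' => (d S').2.2.2.2) (by
      filter_upwards [hd, hvel] with S' ⟨_, h2, h3, h4, _, h8, h5, _, _, h6⟩ h7
      refine ⟨h4, h2.curve.mono (h2.Icc_subset h8), fun r hr => ⟨h5 r ⟨?_, hr.2⟩,
        h7 r (h2.Icc_subset h8 hr)⟩⟩
      linarith [hr.1]) hstart (hd.mono fun S' ⟨_, _, _, _, _, _, _, _, h1, _⟩ => h1)
  obtain ⟨a, ha, ha0, haA⟩ := exists_proj_mem_of_locallyConverges
    (contMDiff_neg_field S.1.contMDiff_one) S.2.isScaling.neg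
    hL.isClosed hA hw.neg hx0 hβ.reverse (hesc' x _ _ hβb hx0) (γ := fun S' t => (d S').2.1 (-t))
    (c := fun S' => (d S').2.2.2.1) (by
      filter_upwards [hd, hvel] with S' ⟨_, h2, h3, h4, h8, _, h5, _, _, h6⟩ h7
      have hsub := h2.reverse.Icc_subset h8
      refine ⟨h3, h2.reverse.curve.mono hsub, fun r hr => ⟨h5 (-r) ⟨neg_le_neg hr.2, ?_⟩,
        h7 (-r) (hsub hr)⟩⟩
      linarith [hr.1]) (by simpa only [neg_zero] using hstart)
      (hd.mono fun S' ⟨_, _, _, _, _, _, _, h1, _, _⟩ => h1)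
  exact hx.2 (hull x β D hβ a c ha0 hc0 ha hc haA hcA)

end

/-! ### Geodesics and integral curves -/

section

variable {E : Type*} [NormedAddCommGroup E] [NormedSpace ℝ E]
  {M : Type*} [TopologicalSpace M] [ChartedSpace E M] [IsManifold 𝓘(ℝ, E) ∞ M]

/-- An integral curve of a spray is the natural lift of its projection. -/
theorem Spray.lift_proj_eqOn {S : Spray E M} {γ : ℝ → TM E M} {J : Set ℝ} (hJ : IsOpen J)
    (hγ : IsMIntegralCurveOn γ S.field J) : EqOn (lift E fun t => (γ t).proj) γ J := by
  intro t ht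
  have h1 := (hγ t ht).hasMFDerivAt (hJ.mem_nhds ht)
  have h2 := HasMFDerivAt.comp t (hasMFDerivAt_proj (γ t)) h1
  refine congrArg (TotalSpace.mk (γ t).proj) ?_
  refine (DFunLike.congr_fun h2.mfderiv (1 : ℝ)).trans ?_
  have h3 : ∀ z : E × E, (ContinuousLinearMap.fst ℝ E E).comp
      ((1 : ℝ →L[ℝ] ℝ).smulRight z) (1 : ℝ) = z.1 := fun z => by simp
  exact (h3 (S.coord (γ t))).trans (S.coord_fst (γ t))

theorem Spray.isGeodesicOn_proj {S : Spray E M} {γ : ℝ → TM E M} {J : Set ℝ} (hJ : IsOpen J)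
    (hJc : J.OrdConnected) (hJn : J.Nonempty) (hγ : IsMIntegralCurveOn γ S.field J) :
    S.IsGeodesicOn (fun t => (γ t).proj) J := by
  refine ⟨hJ, hJc, hJn, fun t ht => ?_⟩
  have heq := S.lift_proj_eqOn hJ hγ
  have h1 := HasMFDerivWithinAt.congr_of_eventuallyEq (hγ t ht)
    (eventually_of_mem self_mem_nhdsWithin heq) (heq ht)
  exact h1.congr_mfderiv
    (congrArg (fun q => (1 : ℝ →L[ℝ] ℝ).smulRight (S.coord q)) (heq ht).symm)

theorem IsCurveFrom.isGeodesicOn_proj {S : Spray E M} {u : TM E M} {γ : ℝ → TM E M} {J : Set ℝ}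
    (hγ : IsCurveFrom S.field u γ J) : S.IsGeodesicOn (fun t => (γ t).proj) J :=
  S.isGeodesicOn_proj hγ.isOpen hγ.ordConnected ⟨0, hγ.zero_mem⟩ hγ.curve

theorem Spray.IsGeodesicOn.isCurveFrom {S : Spray E M} {c : ℝ → M} {J : Set ℝ}
    (hc : S.IsGeodesicOn c J) {t₀ : ℝ} (ht₀ : t₀ ∈ J) :
    IsCurveFrom S.field (lift E c t₀) (fun t => lift E c (t + t₀)) {t | t + t₀ ∈ J} where
  isOpen := hc.1.preimage (continuous_add_const t₀)
  ordConnected := ⟨fun x hx y hy z hz =>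
    hc.2.1.out hx hy ⟨by linarith [hz.1], by linarith [hz.2]⟩⟩
  zero_mem := by rwa [mem_ofPred_eq, zero_add]
  curve := hc.2.2.2.comp_add t₀
  map_zero := by rw [zero_add]

section Uniqueness

variable [T2Space M] {m : ℝ}

/-- A geodesic whose velocity vanishes somewhere is constant. -/
theorem eq_of_vel_lift_eq_zero (S : HomSpray E M m) {c : ℝ → M} {J : Set ℝ}
    (hc : S.1.IsGeodesicOn c J) {t₀ : ℝ} (ht₀ : t₀ ∈ J) (h0 : vel (lift E c t₀) = 0) {t : ℝ}
    (ht : t ∈ J) : c t = c t₀ := by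
  have : T2Space (TM E M) := t2Space_TM
  have h1 := (hc.isCurveFrom ht₀).eqOn S.1.contMDiff_one (S.2.isScaling.isCurveFrom_const h0)
    (x := t - t₀) ⟨by rwa [mem_ofPred_eq, sub_add_cancel], mem_univ _⟩
  simp only [sub_add_cancel] at h1
  exact congrArg TotalSpace.proj h1

/-- For pseudoconvexity it suffices to consider curves of nonzero vectors, since all other geodesics
are constant. -/
theorem isPseudoconvex_of_segments (S : HomSpray E M m)
    (hS : ∀ K : Set M, IsCompact K → ∃ K' : Set M, IsCompact K' ∧ ∀ u γ J, vel u ≠ 0 →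
      IsCurveFrom S.1.field u γ J → ∀ a c, 0 ≤ a → 0 ≤ c → -a ∈ J → c ∈ J →
        (γ (-a)).proj ∈ K → (γ c).proj ∈ K → u.proj ∈ K') : S.1.IsPseudoconvex := by
  intro K hK
  obtain ⟨K', hK', h1⟩ := hS K hK
  refine ⟨K ∪ K', hK.union hK', fun c J hc a ha b hb hab haK hbK t ht => ?_⟩
  have htJ : t ∈ J := hc.2.1.out ha hb ht
  by_cases h0 : vel (lift E c t) = 0
  · left
    rw [← eq_of_vel_lift_eq_zero S hc htJ h0 ha]
    exact haK
  · right
    have e1 : -(t - a) + t = a := by ring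
    have e2 : b - t + t = b := by ring
    refine h1 _ _ _ h0 (hc.isCurveFrom htJ) (t - a) (b - t) (sub_nonneg.2 ht.1)
      (sub_nonneg.2 ht.2) ?_ ?_ ?_ ?_
    · rwa [mem_ofPred_eq, e1]
    · rwa [mem_ofPred_eq, e2]
    · rwa [e1]
    · rwa [e2]

variable [FiniteDimensional ℝ E]

/-- The projection of a trapped maximal curve is an inextendible nonconstant geodesic. -/
theorem not_traps_of_isDisprisoning (S : Spray E M) (hS : S.IsDisprisoning) {L : Set M}
    (hL : IsCompact L) : ¬ Traps S.field L := by
  have : T2Space (TM E M) := t2Space_TM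
  rintro ⟨u, hu, hall⟩
  obtain ⟨γ, J, hγ, hmax⟩ := exists_maximal_isCurveFrom S.contMDiff_one u
  have hlift := S.lift_proj_eqOn hγ.isOpen hγ.curve
  have h0 := hγ.zero_mem
  refine hS (fun t => (γ t).proj) J ⟨hγ.isGeodesicOn_proj, fun c' J' hc' hJJ' heq => ?_⟩ ?_
    ⟨L, hL, fun t ht => hall γ J hγ t ht⟩
  · refine Subset.antisymm ?_ hJJ'
    have h1 := hc'.isCurveFrom (hJJ' h0)
    have h2 : lift E c' 0 = u := by
      have h3 : lift E c' 0 = lift E (fun t => (γ t).proj) 0 := by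
        have hev : c' =ᶠ[𝓝 0] fun t => (γ t).proj :=
          eventually_of_mem (hγ.isOpen.mem_nhds h0) heq
        have h4 : ∀ (p q : M) (a b : E), p = q → a = b →
            (⟨p, a⟩ : TM E M) = ⟨q, b⟩ := by
          rintro p q a b rfl rfl; rfl
        exact h4 _ _ _ _ (heq h0) (DFunLike.congr_fun (hev.mfderiv_eq) (1 : ℝ))
      rw [h3, hlift h0, hγ.map_zero]
    simp only [add_zero, h2] at h1
    have h5 := hmax _ _ h1
    exact h5
  · rintro ⟨p, hp⟩
    refine hu ?_
    have hev : (fun t => (γ t).proj) =ᶠ[𝓝 0] fun _ => p :=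
      eventually_of_mem (hγ.isOpen.mem_nhds h0) hp
    rw [← hγ.map_zero, ← hlift h0]
    have h1 : HasMFDerivAt 𝓘(ℝ, ℝ) 𝓘(ℝ, E) (fun t => (γ t).proj) 0 0 :=
      (hasMFDerivAt_const p (0 : ℝ)).congr_of_eventuallyEq hev
    exact DFunLike.congr_fun h1.mfderiv (1 : ℝ)

theorem isDisprisoning_of_escapes (S : HomSpray E M m)
    (hS : ∀ K, IsCompact K → Escapes S.1.field K) : S.1.IsDisprisoning := by
  have : T2Space (TM E M) := t2Space_TM
  rintro c J ⟨hc, hext⟩ hnc ⟨K, hK, hcK⟩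
  obtain ⟨t₀, ht₀⟩ := hc.2.2.1
  have hu : vel (lift E c t₀) ≠ 0 := fun h0 =>
    hnc ⟨c t₀, fun t ht => eq_of_vel_lift_eq_zero S hc ht₀ h0 ht⟩
  have h1 := hc.isCurveFrom ht₀
  obtain ⟨γ, D, hγ, hmax⟩ := exists_maximal_isCurveFrom S.1.contMDiff_one (lift E c t₀)
  have h2 := hγ.eqOn S.1.contMDiff_one h1
  have hsub := hmax _ _ h1
  -- the maximal curve is a geodesic that extends `c`
  have h3 : {t | t - t₀ ∈ D} = J := by
    refine hext (fun t => (γ (t - t₀)).proj) {t | t - t₀ ∈ D} ?_ ?_ ?_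
    · refine S.1.isGeodesicOn_proj (γ := fun t => γ (t - t₀)) (hγ.isOpen.preimage
        (continuous_sub_right t₀)) ⟨fun x hx y hy z hz => hγ.ordConnected.out hx hy
          ⟨by linarith [hz.1], by linarith [hz.2]⟩⟩ ⟨t₀, ?_⟩ (hγ.curve.comp_add (-t₀))
      rw [mem_ofPred_eq, sub_self]
      exact hγ.zero_mem
    · exact fun t ht => hsub (show t - t₀ + t₀ ∈ J by rwa [sub_add_cancel])
    · intro t ht
      have h4 : t - t₀ + t₀ ∈ J := by rwa [sub_add_cancel]
      have h5 := h2 ⟨hsub h4, h4⟩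
      simp only [sub_add_cancel] at h5
      exact congrArg TotalSpace.proj h5
  obtain ⟨t, ht, _, htK⟩ := hS K hK _ γ D ⟨hγ, fun γ' J' h' t ht _ => hmax γ' J' h' ht⟩ hu
  have h4 : t + t₀ ∈ J := by rw [← h3, mem_ofPred_eq, add_sub_cancel_right]; exact ht
  refine htK ?_
  rw [h2 ⟨ht, h4⟩]
  exact hcK _ h4

end Uniqueness

theorem Spray.IsPseudoconvex.segments {S : Spray E M} (hS : S.IsPseudoconvex) {K : Set M}
    (hK : IsCompact K) : ∃ K' : Set M, IsCompact K' ∧ ∀ u γ J,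
      IsCurveFrom S.field u γ J → ∀ a c, 0 ≤ a → 0 ≤ c → -a ∈ J → c ∈ J →
        (γ (-a)).proj ∈ K → (γ c).proj ∈ K → u.proj ∈ K' := by
  obtain ⟨K', hK', h1⟩ := hS K hK
  refine ⟨K', hK', fun u γ J hγ a c ha hc haJ hcJ haK hcK => ?_⟩
  rw [← hγ.map_zero]
  exact h1 _ _ hγ.isGeodesicOn_proj _ haJ _ hcJ (by linarith) haK hcK 0
    ⟨neg_nonpos.2 ha, hc⟩

end

/-! ### From compact sets to the whole manifold -/

section

variable {E : Type*} [NormedAddCommGroup E] [NormedSpace ℝ E]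
  {M : Type*} [TopologicalSpace M] [ChartedSpace E M] [IsManifold 𝓘(ℝ, E) ∞ M]

/-- Properties that hold near `S` over each member of a locally finite family of closed sets hold
simultaneously on a neighbourhood of `S` in the fine topology. -/
theorem exists_isOpen_fineTopology
    (h : ContMDiffRiemannianMetric 𝓘(ℝ, E) ∞ E (fun x : M => TangentSpace 𝓘(ℝ, E) x)) {m : ℝ}
    (S : HomSpray E M m) {ι : Type*} {L : ι → Set M} (hL : ∀ i, IsClosed (L i))
    (hLf : LocallyFinite L) {P : ι → HomSpray E M m → Prop}
    (hP : ∀ i, ∀ᶠ S' in nearOver h (L i) S, P i S') :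
    ∃ W : Set (HomSpray E M m), IsOpen[fineTopology m h] W ∧ S ∈ W ∧ ∀ S' ∈ W, ∀ i, P i S' := by
  choose O hO hSO hOP using fun i => (eventually_nearOver h).1 (hP i)
  have hπ : Continuous fun ξ : TTM E M => ξ.proj.proj :=
    continuous_proj_TM.comp
      (FiberBundle.continuous_proj (E × E) (TangentSpace 𝓘(ℝ, E).tangent))
  have hbad : IsClosed (⋃ i, (fun ξ : TTM E M => ξ.proj.proj) ⁻¹' (L i) ∩ (O i)ᶜ) := by
    refine LocallyFinite.isClosed_iUnion ?_ fun i => ((hL i).preimage hπ).inter (hO i).isClosed_compl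
    exact (hLf.preimage_continuous hπ).subset fun i => inter_subset_left
  refine ⟨{S' | ∀ u ∈ unitBundle h, (⟨u, S'.1.field u⟩ : TTM E M) ∈
    (⋃ i, (fun ξ : TTM E M => ξ.proj.proj) ⁻¹' (L i) ∩ (O i)ᶜ)ᶜ}, ?_, ?_, ?_⟩
  · exact TopologicalSpace.isOpen_generateFrom_of_mem ⟨_, hbad.isOpen_compl, rfl⟩
  · intro u hu hc
    obtain ⟨i, hi, hi'⟩ := mem_iUnion.1 hc
    exact hi' (hSO i u hu hi)
  · intro S' hS' i
    refine hOP i S' fun u hu huL => ?_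
    by_contra hc
    exact hS' u hu (mem_iUnion.2 ⟨i, huL, hc⟩)

/-- A continuous curve that is outside the closed set `A` at time `t` has a last time before `t` in
`A`; from then on it avoids the interior of `A`. -/
theorem exists_last_exit {X : Type*} [TopologicalSpace X] {g : ℝ → X} {b t : ℝ} (hbt : b ≤ t)
    (hg : ContinuousOn g (Icc b t)) {A : Set X} (hA : IsClosed A) (hb : g b ∈ A) (ht : g t ∉ A) :
    ∃ s ∈ Icc b t, g s ∈ A ∧ ∀ r ∈ Icc s t, g r ∉ interior A := by
  have hcl : IsCompact (Icc b t ∩ g ⁻¹' A) :=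
    isCompact_Icc.of_isClosed_subset (hg.preimage_isClosed_of_isClosed isClosed_Icc hA)
      inter_subset_left
  obtain ⟨s, ⟨hs, hsA⟩, hmax⟩ := hcl.exists_isGreatest ⟨b, left_mem_Icc.2 hbt, hb⟩
  have hout : ∀ r ∈ Ioc s t, g r ∉ A := fun r hr hrA =>
    absurd (hmax ⟨⟨hs.1.trans hr.1.le, hr.2⟩, hrA⟩) (not_le.2 hr.1)
  have hst : s < t := lt_of_le_of_ne hs.2 fun h => ht (h ▸ hsA)
  refine ⟨s, hs, hsA, fun r hr hri => ?_⟩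
  rcases eq_or_lt_of_le hr.1 with rfl | hlt
  · -- just after `s` the curve is outside `A`
    have h1 : ContinuousWithinAt g (Ioc s t) s :=
      (hg s hs).mono fun x hx => ⟨hs.1.trans hx.1.le, hx.2⟩
    have h2 := h1 (isOpen_interior.mem_nhds hri)
    have : (𝓝[Ioc s t] s).NeBot := by
      rw [nhdsWithin_Ioc_eq_nhdsGT hst]; infer_instance
    obtain ⟨x, hx1, hx2⟩ := (Filter.Eventually.and (mem_map.1 h2) self_mem_nhdsWithin).exists
    exact hout x hx2 (interior_subset hx1)
  · exact hout r ⟨hlt, hr.2⟩ (interior_subset hri)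

/-- A compact exhaustion of `M` that is adapted to the pseudoconvex spray `S`: segments of
`S`-geodesics with endpoints in a member of the exhaustion stay in the interior of the next one. -/
structure IsAdaptedExhaustion (S : Spray E M) (K : ℕ → Set M) : Prop where
  zero : K 0 = ∅
  isCompact : ∀ n, IsCompact (K n)
  subset_interior : ∀ n, K n ⊆ interior (K (n + 1))
  exists_mem : ∀ x, ∃ n, x ∈ K n
  hull : ∀ n u γ J, IsCurveFrom S.field u γ J → ∀ a c, 0 ≤ a → 0 ≤ c → -a ∈ J → c ∈ J →
    (γ (-a)).proj ∈ K n → (γ c).proj ∈ K n → u.proj ∈ interior (K (n + 1))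

namespace IsAdaptedExhaustion

variable {S : Spray E M} {K : ℕ → Set M}

/-- The shell between two members of the exhaustion. Each shell overlaps its neighbours. -/
def shell (K : ℕ → Set M) (n : ℕ) : Set M := K (n + 2) \ interior (K n)

theorem monotone (h : IsAdaptedExhaustion S K) : Monotone K :=
  monotone_nat_of_le_succ fun n => (h.subset_interior n).trans interior_subset

theorem isCompact_shell (h : IsAdaptedExhaustion S K) (n : ℕ) : IsCompact (shell K n) :=
  (h.isCompact _).diff isOpen_interior

theorem locallyFinite_shell (h : IsAdaptedExhaustion S K) : LocallyFinite (shell K) := by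
  intro x
  obtain ⟨n, hn⟩ := h.exists_mem x
  refine ⟨interior (K (n + 1)), isOpen_interior.mem_nhds (h.subset_interior n hn),
    (finite_lt_nat (n + 1)).subset ?_⟩
  rintro k ⟨y, hy, hyn⟩
  by_contra! hk
  exact hy.2 (interior_mono (h.monotone (not_lt.1 hk)) hyn)

theorem exists_subset (h : IsAdaptedExhaustion S K) {C : Set M} (hC : IsCompact C) :
    ∃ n, C ⊆ K n := by
  obtain ⟨n, hn⟩ := hC.elim_directed_cover (fun n => interior (K (n + 1)))
    (fun _ => isOpen_interior) (fun x _ => by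
      obtain ⟨n, hn⟩ := h.exists_mem x
      exact mem_iUnion.2 ⟨n, h.subset_interior n hn⟩)
    (Monotone.directed_le fun a b hab => interior_mono (h.monotone (by omega)))
  exact ⟨n + 1, hn.trans interior_subset⟩

end IsAdaptedExhaustion

open IsAdaptedExhaustion

variable [FiniteDimensional ℝ E] [T2Space M]

theorem exists_isAdaptedExhaustion [ParacompactSpace M] [ConnectedSpace M] {S : Spray E M}
    (hS : S.IsPseudoconvex) : ∃ K, IsAdaptedExhaustion S K := by
  have : LocallyCompactSpace M := Manifold.locallyCompact_of_finiteDimensional 𝓘(ℝ, E)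
  have : SigmaCompactSpace M := sigmaCompactSpace_of_connected_paracompact M
  obtain ⟨C⟩ : Nonempty (CompactExhaustion M) := inferInstance
  have hstep : ∀ (n : ℕ) (B : Set M), ∃ B', IsCompact B → IsCompact B' ∧ B ⊆ interior B' ∧
      C n ⊆ B' ∧ ∀ u γ J, IsCurveFrom S.field u γ J → ∀ a c, 0 ≤ a → 0 ≤ c → -a ∈ J → c ∈ J →
        (γ (-a)).proj ∈ B → (γ c).proj ∈ B → u.proj ∈ interior B' := by
    intro n B
    by_cases hB : IsCompact B
    · obtain ⟨B₁, hB₁, h1⟩ := hS.segments hB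
      obtain ⟨B', hB', h2⟩ := exists_compact_superset ((hB.union hB₁).union (C.isCompact n))
      refine ⟨B', fun _ => ⟨hB', fun x hx => h2 (Or.inl (Or.inl hx)),
        fun x hx => interior_subset (h2 (Or.inr hx)), ?_⟩⟩
      exact fun u γ J hγ a c ha hc haJ hcJ haB hcB =>
        h2 (Or.inl (Or.inr (h1 u γ J hγ a c ha hc haJ hcJ haB hcB)))
    · exact ⟨∅, fun h => absurd h hB⟩
  choose f hf using hstep
  let K : ℕ → Set M := fun n => Nat.rec ∅ (fun n B => f n B) n
  have hK : ∀ n, IsCompact (K n) := by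
    intro n
    induction n with
    | zero => exact isCompact_empty
    | succ n ih => exact (hf n (K n) ih).1
  exact ⟨K, rfl, hK, fun n => (hf n (K n) (hK n)).2.1,
    fun x => (C.exists_mem x).imp' Nat.succ fun n hn => (hf n (K n) (hK n)).2.2.1 hn,
    fun n => (hf n (K n) (hK n)).2.2.2⟩

/-- Integral curves of `w` that run in the shell `K (n + 2) \ interior (K n)` between two points over
`K n` stay over the interior of `K (n + 1)`. The curves are parametrized so that the point under
consideration is at time `0`. -/
def ShellConvex (w : (q : TM E M) → TangentSpace 𝓘(ℝ, E).tangent q) (K : ℕ → Set M) : Prop :=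
  ∀ n u γ J, vel u ≠ 0 → IsCurveFrom w u γ J →
    ∀ a c, 0 ≤ a → 0 ≤ c → -a ∈ J → c ∈ J → (∀ r ∈ Icc (-a) c, (γ r).proj ∈ shell K n) →
      (γ (-a)).proj ∈ K n → (γ c).proj ∈ K n → u.proj ∈ interior (K (n + 1))

/-- Convexity over the shells bounds arbitrary segments, which may run through many shells. -/
theorem ShellConvex.segment {S : Spray E M} {K : ℕ → Set M} (hK : IsAdaptedExhaustion S K)
    {w : (q : TM E M) → TangentSpace 𝓘(ℝ, E).tangent q}
    (hws : ContMDiff 𝓘(ℝ, E).tangent 𝓘(ℝ, E).tangent.tangent 1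
      (fun x => (⟨x, w x⟩ : TangentBundle 𝓘(ℝ, E).tangent (TM E M))))
    (hsc : IsScaling w) (hw : ShellConvex w K) {n : ℕ} {u : TM E M} {γ : ℝ → TM E M} {J : Set ℝ}
    (hu : vel u ≠ 0) (hγ : IsCurveFrom w u γ J) {a c : ℝ} (ha : a ∈ J) (hc : c ∈ J)
    (haK : (γ a).proj ∈ K n) (hcK : (γ c).proj ∈ K n) {t : ℝ} (ht : t ∈ Icc a c) :
    (γ t).proj ∈ K (n + 1) := by
  have hsub : Icc a c ⊆ J := hγ.ordConnected.out ha hc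
  have hg : ContinuousOn (fun r => (γ r).proj) (Icc a c) :=
    continuous_proj_TM.comp_continuousOn (hγ.curve.continuousOn.mono hsub)
  -- descend through the exhaustion, from a member that contains the whole segment
  suffices H : ∀ k, (∀ r ∈ Icc a c, (γ r).proj ∈ K (n + 1 + k)) →
      ∀ r ∈ Icc a c, (γ r).proj ∈ K (n + 1) by
    obtain ⟨N, hN⟩ := hK.exists_subset (isCompact_Icc.image_of_continuousOn hg)
    exact H N (fun r hr => hK.monotone (by omega) (hN (mem_image_of_mem _ hr))) t ht
  intro k
  induction k with
  | zero => exact fun h => h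
  | succ k ih =>
    refine fun hall => ih fun r hr => ?_
    by_cases hrK : (γ r).proj ∈ K (n + k)
    · exact hK.monotone (by omega) hrK
    have hmono : K n ⊆ K (n + k) := hK.monotone (by omega)
    -- cut the segment at the last exit from and the next return to `K (n + k)`
    obtain ⟨s, hs, hsK, hsr⟩ := exists_last_exit hr.1 (hg.mono (Icc_subset_Icc_right hr.2))
      (hK.isCompact (n + k)).isClosed (hmono haK) hrK
    obtain ⟨s', hs', hsK', hsr'⟩ := exists_last_exit (g := fun x => (γ (-x)).proj)
      (b := -c) (t := -r) (neg_le_neg hr.2)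
      (hg.comp continuous_neg.continuousOn fun x hx => ⟨by linarith [hx.2, hr.1], by linarith [hx.1]⟩)
      (hK.isCompact (n + k)).isClosed (by rw [neg_neg]; exact hmono hcK) (by rwa [neg_neg])
    have h1 := hw (n + k) (γ r) _ _ (hγ.vel_ne_zero hws hsc hu (hsub hr)) (hγ.shift (hsub hr))
      (r - s) (-s' - r) (by linarith [hs.2]) (by linarith [hs'.2])
      (by rw [mem_ofPred_eq]; exact hsub ⟨by linarith [hs.1], by linarith [hs.2, hr.2]⟩)
      (by rw [mem_ofPred_eq]; exact hsub ⟨by linarith [hs'.2, hr.1], by linarith [hs'.1]⟩)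
      (fun x hx => by
        refine ⟨?_, ?_⟩
        · have := hall (x + r) ⟨by linarith [hx.1, hs.1], by linarith [hx.2, hs'.1]⟩
          rwa [show n + 1 + (k + 1) = n + k + 2 by omega] at this
        · rcases le_total x 0 with hx0 | hx0
          · exact hsr (x + r) ⟨by linarith [hx.1], by linarith⟩
          · have := hsr' (-(x + r)) ⟨by linarith [hx.2], by linarith⟩
            rwa [neg_neg] at this)
      (by rwa [show -(r - s) + r = s by ring]) (by rwa [show -s' - r + r = -s' by ring])
    rw [show n + 1 + k = n + k + 1 by omega]
    exact interior_subset h1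

/-- If `w` is convex and traps nothing in the shells, its curves leave every compact set: a curve
over a compact set would by convexity eventually stay in a shell. -/
theorem ShellConvex.escapes
    (h : ContMDiffRiemannianMetric 𝓘(ℝ, E) ∞ E (fun x : M => TangentSpace 𝓘(ℝ, E) x))
    {S : Spray E M} {K : ℕ → Set M} (hK : IsAdaptedExhaustion S K)
    {w : (q : TM E M) → TangentSpace 𝓘(ℝ, E).tangent q}
    (hws : ContMDiff 𝓘(ℝ, E).tangent 𝓘(ℝ, E).tangent.tangent 1
      (fun x => (⟨x, w x⟩ : TangentBundle 𝓘(ℝ, E).tangent (TM E M))))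
    (hsc : IsScaling w) (hw : ShellConvex w K) (hnt : ∀ n, ¬ Traps w (shell K n)) {C : Set M}
    (hC : IsCompact C) : Escapes w C := by
  intro u γ J hγ hu
  by_contra! hstay
  have hex : ∃ n, ∃ τ ∈ J, 0 ≤ τ ∧ ∀ t ∈ J, τ ≤ t → (γ t).proj ∈ K n := by
    obtain ⟨n, hn⟩ := hK.exists_subset hC
    exact ⟨n, 0, hγ.zero_mem, le_rfl, fun t ht ht0 => hn (hstay t ht ht0)⟩
  classical
  obtain ⟨τ, hτ, hτ0, hτK⟩ := Nat.find_spec hex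
  set n := Nat.find hex with hn
  have hmin : ∀ k < n, ¬ ∃ τ ∈ J, 0 ≤ τ ∧ ∀ t ∈ J, τ ≤ t → (γ t).proj ∈ K k := fun k hk =>
    Nat.find_min hex hk
  -- the curve is eventually over a shell
  have hshell : ∃ k, ∃ σ ∈ J, 0 ≤ σ ∧ ∀ t ∈ J, σ ≤ t → (γ t).proj ∈ shell K k := by
    by_cases hn2 : n < 2
    · refine ⟨0, τ, hτ, hτ0, fun t ht hτt => ⟨hK.monotone (by omega) (hτK t ht hτt), ?_⟩⟩
      rw [hK.zero, interior_empty]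
      exact notMem_empty _
    · obtain ⟨k, hk⟩ : ∃ k, n = k + 2 := ⟨n - 2, by omega⟩
      by_contra! hcon
      have hrec : ∀ σ ∈ J, τ ≤ σ → ∃ t ∈ J, σ ≤ t ∧ (γ t).proj ∈ K k := by
        intro σ hσ hτσ
        obtain ⟨t, ht, hσt, hts⟩ := hcon k σ hσ (hτ0.trans hτσ)
        refine ⟨t, ht, hσt, ?_⟩
        by_contra hc
        have h1 := hτK t ht (hτσ.trans hσt)
        rw [hk] at h1
        exact hts ⟨h1, fun hi => hc (interior_subset hi)⟩
      obtain ⟨t₁, ht₁, hτt₁, ht₁K⟩ := hrec τ hτ le_rfl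
      refine hmin (k + 1) (by omega) ⟨t₁, ht₁, hτ0.trans hτt₁, fun t ht htt => ?_⟩
      obtain ⟨t₂, ht₂, htt₂, ht₂K⟩ := hrec t ht (hτt₁.trans htt)
      exact hw.segment hK hws hsc hu hγ.toIsCurveFrom ht₁ ht₂ ht₁K ht₂K ⟨htt, htt₂⟩
  obtain ⟨k, σ, hσ, hσ0, hσK⟩ := hshell
  obtain ⟨t, ht, ht0, htK⟩ := escapes_of_not_traps h hws hsc (hK.isCompact_shell k) (hnt k) _ _ _
    (hγ.shift hws hσ hσ0) (hγ.vel_ne_zero hws hsc hu hσ)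
  exact htK (hσK _ ht (by linarith))

end

end Spr

end

end

/-! ### The stability theorem -/

theorem mainTheorem4
    {E : Type*} [NormedAddCommGroup E] [NormedSpace ℝ E] [FiniteDimensional ℝ E]
    {M : Type*} [TopologicalSpace M] [ChartedSpace E M] [IsManifold 𝓘(ℝ, E) ∞ M]
    [T2Space M] [ParacompactSpace M] [ConnectedSpace M]
    (h : ContMDiffRiemannianMetric 𝓘(ℝ, E) ∞ E (fun x : M => TangentSpace 𝓘(ℝ, E) x))
    (m : ℝ) (hm : 0 ≤ m) (S : Spr.HomSpray E M m)
    (hS_pc : S.1.IsPseudoconvex) (hS_dis : S.1.IsDisprisoning) :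
    ∃ W : Set (Spr.HomSpray E M m),
      IsOpen[Spr.fineTopology m h] W ∧ S ∈ W ∧
        ∀ S' ∈ W, S'.1.IsPseudoconvex ∧ S'.1.IsDisprisoning := by
  obtain ⟨K, hK⟩ := Spr.exists_isAdaptedExhaustion hS_pc
  have hnt : ∀ n, ¬ Spr.Traps S.1.field (Spr.IsAdaptedExhaustion.shell K n) := fun n =>
    Spr.not_traps_of_isDisprisoning S.1 hS_dis (hK.isCompact_shell n)
  have hesc := fun n => Spr.escapes_of_not_traps h S.1.contMDiff_one S.2.isScaling
    (hK.isCompact_shell n) (hnt n)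
  have hesc' := fun n => Spr.escapes_of_not_traps h (Spr.contMDiff_neg_field S.1.contMDiff_one)
    S.2.isScaling.neg (hK.isCompact_shell n) fun htr => hnt n htr.of_neg
  obtain ⟨W, hW, hSW, hWP⟩ := Spr.exists_isOpen_fineTopology h S
    (fun n => (hK.isCompact_shell n).isClosed) hK.locallyFinite_shell fun n =>
    (Spr.eventually_not_traps h (hK.isCompact_shell n) S (hesc n)).and
      (Spr.eventually_proj_mem_of_segment h (hK.isCompact_shell n) (hK.isCompact n).isClosed
        isOpen_interior S (hesc n) (hesc' n) (hK.hull n))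
  refine ⟨W, hW, hSW, fun S' hS' => ?_⟩
  have hconv : Spr.ShellConvex S'.1.field K := fun n => (hWP S' hS' n).2
  refine ⟨Spr.isPseudoconvex_of_segments S' fun C hC => ?_,
    Spr.isDisprisoning_of_escapes S' fun C hC => hconv.escapes h hK S'.1.contMDiff_one
      S'.2.isScaling (fun n => (hWP S' hS' n).1) hC⟩
  obtain ⟨n, hn⟩ := hK.exists_subset hC
  refine ⟨K (n + 1), hK.isCompact _, fun u γ J hu hγ a c ha hc haJ hcJ haC hcC => ?_⟩
  rw [← hγ.map_zero]
  exact hconv.segment hK S'.1.contMDiff_one S'.2.isScaling hu hγ haJ hcJ (hn haC) (hn hcC)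
    ⟨neg_nonpos.2 ha, hc⟩
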